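/- Let $d\in\mathbb N_0$, let $X\subseteq\mathbb R^d$ be open, let $w\in C^\infty(X)$ be complex-valued such that $\{x\in X : w(x)\neq 0\}$ is dense in $X$, and let $\psi:X\to X$ be smooth and injective with $\det J\psi(x)\neq 0$ for all $x\in X$, where $J\psi$ denotes the Jacobian matrix. Let $\mathscr D'(X)$ be the space of complex distributions on $X$ with the strong dual topology. There is a unique continuous linear operator $C_{w,\psi}$ on $\mathscr D'(X)$ which extends the operator $f\mapsto w\,(f\circ\psi)$ on $C(X)$ (the weighted composition operator). We use the following notions. A continuous linear operator $T$ on a locally convex space $E$ is power bounded if for every continuous seminorm $p$ on $E$ there is a continuous seminorm $q$ on $E$ with $p(T^m x)\le q(x)$ for all $m\in\mathbb N_0$ and $x\in E$. The map $\psi$ has stable orbits if for every compact $K\subseteq X$ there is a compact $L\subseteq X$ with $\psi^m(K)\subseteq L$ for all $m\in\mathbb N_0$. Here $\psi^m$ is the $m$-fold iterate; it is a diffeomorphism from $X$ onto the open set $\psi^m(X)$, and $(\psi^m)^{-1}_c$, $1\le c\le d$, denote the components of its inverse $(\psi^m)^{-1}:\psi^m(X)\to X\subseteq\mathbb R^d$.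 For $f$ smooth on an open set containing the compact set $K$ and for $n\in\mathbb N_0$ put $\|f\|_{n,K}=\sup_{|\alpha|\le n,\,x\in K}|\partial^\alpha f(x)|$. Consider the conditions $$\text{(a)}\qquad \sup_{m\in\mathbb N_0}\Big\|\Big(\prod_{j=0}^{m-1}\frac{w(\psi^j(\cdot))}{|\det J\psi(\psi^j(\cdot))|}\Big)\circ(\psi^m)^{-1}\Big\|_{n,\psi^m(K)}<\infty\quad\text{for all compact }K\subseteq X\text{ and all }n\in\mathbb N_0,$$ $$\text{(b)}\qquad \sup_{m\in\mathbb N_0}\big\|(\psi^m)^{-1}_c\big\|_{n,\psi^m(K)}<\infty\quad\text{for all compact }K\subseteq X,\text{ all }n\in\mathbb N_0\text{ and all }1\le c\le d.$$ Then the following hold. (i) If $\psi$ has stable orbits and (a) and (b) hold, then $C_{w,\psi}$ is power bounded on $\mathscr D'(X)$. (ii) Conversely, if $C_{w,\psi}$ is power bounded on $\mathscr D'(X)$, then $\psi$ has stable orbits and (a) holds. -/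

import Mathlib

open Set Function TopologicalSpace MeasureTheory
open scoped ENNReal ContDiff Distributions

namespace WeightedComposition

/-- The space `𝓓'(X)` of complex distributions on the open set `X ⊆ ℝ^d`: continuous linear
functionals on the LF-space `𝓓(X)` of complex-valued test functions. As the type of continuous
linear maps it carries the topology of uniform convergence on bounded subsets of `𝓓(X)`, i.e. the
strong dual topology. -/
abbrev Distr {d : ℕ} (X : Opens (EuclideanSpace ℝ (Fin d))) : Type :=
  𝓓(X, ℂ) →L[ℂ] ℂ

/-- The regular distribution `φ ↦ ∫ φ f` of a function that is locally integrable on `X`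
(in particular of a function that is continuous on `X`). -/
noncomputable def regularDistr {d : ℕ} (X : Opens (EuclideanSpace ℝ (Fin d)))
    (f : EuclideanSpace ℝ (Fin d) → ℂ) : Distr X :=
  TestFunction.integralAgainstBilinCLM (ContinuousLinearMap.mul ℂ ℂ) volume f

/-- `T` is a continuous linear operator on `𝓓'(X)` which extends the operator
`f ↦ w · (f ∘ ψ)` on `C(X)`. -/
def IsWeightedCompositionOperator {d : ℕ} (X : Opens (EuclideanSpace ℝ (Fin d)))
    (w : EuclideanSpace ℝ (Fin d) → ℂ)
    (ψ : EuclideanSpace ℝ (Fin d) → EuclideanSpace ℝ (Fin d))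
    (T : Distr X →L[ℂ] Distr X) : Prop :=
  ∀ f : EuclideanSpace ℝ (Fin d) → ℂ, ContinuousOn f X →
    T (regularDistr X f) = regularDistr X (fun x => w x * f (ψ x))

/-- A continuous linear operator on a topological vector space is power bounded if for every
continuous seminorm `p` there is a continuous seminorm `q` such that `p (T ^ m x) ≤ q x` for all
`m` and `x`. -/
def IsPowerBounded {E : Type*} [AddCommGroup E] [Module ℂ E] [TopologicalSpace E]
    (T : E →L[ℂ] E) : Prop :=
  ∀ p : Seminorm ℂ E, Continuous p →
    ∃ q : Seminorm ℂ E, Continuous q ∧ ∀ (m : ℕ) (x : E), p (T^[m] x) ≤ q x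

/-- The self-map `ψ` of the set `X` has stable orbits: for every compact `K ⊆ X` there is a compact
`L ⊆ X` which contains `ψ^m(K)` for all `m`. -/
def HasStableOrbits {E : Type*} [TopologicalSpace E] (X : Set E) (ψ : E → E) : Prop :=
  ∀ K : Set E, IsCompact K → K ⊆ X →
    ∃ L : Set E, IsCompact L ∧ L ⊆ X ∧ ∀ m : ℕ, ψ^[m] '' K ⊆ L

/-- The seminorm `‖f‖_{n,K} = sup { |∂^α f(x)| : |α| ≤ n, x ∈ K }` with values in `[0, ∞]`, for `f`
smooth on a neighbourhood of `K`. The partial derivatives of order `k` are written as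
`∂_{β 0} ⋯ ∂_{β (k-1)} f`, with `β` running through all sequences of `k` coordinate directions. -/
noncomputable def cnSeminorm {d : ℕ} {F : Type*} [NormedAddCommGroup F] [NormedSpace ℝ F]
    (n : ℕ) (K : Set (EuclideanSpace ℝ (Fin d))) (f : EuclideanSpace ℝ (Fin d) → F) : ℝ≥0∞ :=
  ⨆ (k : ℕ) (_ : k ≤ n) (β : Fin k → Fin d) (x : EuclideanSpace ℝ (Fin d)) (_ : x ∈ K),
    ‖iteratedFDeriv ℝ k f x (fun i => EuclideanSpace.single (β i) (1 : ℝ))‖ₑ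

/-- `(ψ^m)⁻¹ : ψ^m(X) → X`, the inverse of the injective map `ψ^m : X → ψ^m(X)`
(only its values on `ψ^m(X)` are meaningful). -/
noncomputable def iterateInv {d : ℕ} (X : Set (EuclideanSpace ℝ (Fin d)))
    (ψ : EuclideanSpace ℝ (Fin d) → EuclideanSpace ℝ (Fin d)) (m : ℕ) :
    EuclideanSpace ℝ (Fin d) → EuclideanSpace ℝ (Fin d) :=
  invFunOn (ψ^[m]) X

/-- The weight product `x ↦ ∏_{j < m} w(ψ^j(x)) / |det Jψ(ψ^j(x))|`. -/
noncomputable def weightProduct {d : ℕ} (w : EuclideanSpace ℝ (Fin d) → ℂ)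
    (ψ : EuclideanSpace ℝ (Fin d) → EuclideanSpace ℝ (Fin d)) (m : ℕ)
    (x : EuclideanSpace ℝ (Fin d)) : ℂ :=
  ∏ j ∈ Finset.range m, w (ψ^[j] x) / ((|(fderiv ℝ ψ (ψ^[j] x)).det| : ℝ) : ℂ)

/-- For all compact `K ⊆ X` and all `n`, the functions
`(∏_{j < m} w(ψ^j(·)) / |det Jψ(ψ^j(·))|) ∘ (ψ^m)⁻¹` are bounded in `‖·‖_{n, ψ^m(K)}`
uniformly in `m`. -/
def WeightProductsBounded {d : ℕ} (X : Set (EuclideanSpace ℝ (Fin d)))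
    (w : EuclideanSpace ℝ (Fin d) → ℂ)
    (ψ : EuclideanSpace ℝ (Fin d) → EuclideanSpace ℝ (Fin d)) : Prop :=
  ∀ K : Set (EuclideanSpace ℝ (Fin d)), IsCompact K → K ⊆ X → ∀ n : ℕ,
    ⨆ m : ℕ, cnSeminorm n (ψ^[m] '' K) (weightProduct w ψ m ∘ iterateInv X ψ m) < ⊤

/-- For all compact `K ⊆ X`, all `n` and every coordinate `c`, the components `(ψ^m)⁻¹_c` are
bounded in `‖·‖_{n, ψ^m(K)}` uniformly in `m`. -/
def InverseComponentsBounded {d : ℕ} (X : Set (EuclideanSpace ℝ (Fin d)))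
    (ψ : EuclideanSpace ℝ (Fin d) → EuclideanSpace ℝ (Fin d)) : Prop :=
  ∀ K : Set (EuclideanSpace ℝ (Fin d)), IsCompact K → K ⊆ X → ∀ (n : ℕ) (c : Fin d),
    ⨆ m : ℕ, cnSeminorm n (ψ^[m] '' K) (fun y => iterateInv X ψ m y c) < ⊤

end WeightedComposition

/-!
The operator `C_{w,ψ}` is the transpose of `S f = (w / |det Jψ| · f) ∘ ψ⁻¹` on the space `𝓓(X)` of
test functions. Since the seminorms `u ↦ sup {|u f| : f ∈ B}` with `B` bounded define the strong
topology, the bipolar theorem shows that the transpose of `S` is power bounded if and only if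
`⋃ m, S^m(B)` is bounded for every bounded `B`. A set of test functions is bounded if and only if
its elements are supported in a common compact subset of `X` and their derivatives of each order
are uniformly bounded.

The iterate `S^m f` equals `(W_m · f) ∘ (ψ^m)⁻¹` for the weight product `W_m` and is supported in
`ψ^m(supp f)`. Hence stable orbits together with the bounds on `W_m ∘ (ψ^m)⁻¹` and `(ψ^m)⁻¹` make
`⋃ m, S^m(B)` bounded. Conversely, if `f = 1` near `K`, then `S^m f` is `W_m ∘ (ψ^m)⁻¹` near
`ψ^m(K)`, and its support contains `ψ^m(K)` because `W_m` does not vanish on any nonempty open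
subset of `X`; so the boundedness of the orbit of `f` gives the estimates for the weight products
and the stability of the orbit of `K`.

Uniqueness holds because the continuous functions are dense in the space of distributions: on a
bounded set of test functions, a distribution is approximated uniformly by its mollifications.
-/

namespace WeightedComposition

section StrongDual

variable {𝕜 V : Type*} [RCLike 𝕜] [AddCommGroup V] [Module 𝕜 V] [TopologicalSpace V]

theorem bddAbove_range_norm_apply {B : Set V} (hB : Bornology.IsVonNBounded 𝕜 B)
    (u : V →L[𝕜] 𝕜) : BddAbove (range fun x : B ↦ ‖u x‖) := by
  obtain ⟨M, hM⟩ := (NormedSpace.image_isVonNBounded_iff 𝕜).1 (hB.image u)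
  exact ⟨M, forall_mem_range.2 fun x ↦ hM x x.2⟩

/-- The seminorm `u ↦ sup {|u x| : x ∈ B}` on the dual of `V`, for `B` bounded. These seminorms
define the strong topology. -/
noncomputable def supSeminorm (B : Set V) (hB : Bornology.IsVonNBounded 𝕜 B) :
    Seminorm 𝕜 (V →L[𝕜] 𝕜) :=
  Seminorm.of (fun u ↦ ⨆ x : B, ‖u x‖)
    (fun u v ↦ Real.iSup_le (fun x ↦ (norm_add_le _ _).trans (add_le_add
        (le_ciSup (bddAbove_range_norm_apply hB u) x)
        (le_ciSup (bddAbove_range_norm_apply hB v) x)))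
      (add_nonneg (Real.iSup_nonneg fun _ ↦ norm_nonneg _)
        (Real.iSup_nonneg fun _ ↦ norm_nonneg _)))
    (fun a u ↦ by
      simp only [_root_.smul_apply, norm_smul]
      rw [Real.mul_iSup_of_nonneg (norm_nonneg a)])

variable {B : Set V} (hB : Bornology.IsVonNBounded 𝕜 B)

theorem norm_apply_le_supSeminorm (u : V →L[𝕜] 𝕜) {x : V} (hx : x ∈ B) :
    ‖u x‖ ≤ supSeminorm B hB u :=
  le_ciSup (bddAbove_range_norm_apply hB u) ⟨x, hx⟩

theorem supSeminorm_le {u : V →L[𝕜] 𝕜} {M : ℝ} (hM : 0 ≤ M) (h : ∀ x ∈ B, ‖u x‖ ≤ M) :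
    supSeminorm B hB u ≤ M :=
  Real.iSup_le (fun x ↦ h x x.2) hM

theorem continuous_supSeminorm : Continuous (supSeminorm B hB) := by
  refine Seminorm.continuous' (r := 1) ?_
  refine (ContinuousLinearMap.hasBasis_nhds_zero_of_basis
    (Metric.nhds_basis_closedBall (x := (0 : 𝕜)))).mem_iff.2 ⟨⟨B, 1⟩, ⟨hB, one_pos⟩, fun u hu ↦ ?_⟩
  rw [Seminorm.mem_closedBall_zero]
  exact supSeminorm_le hB zero_le_one fun x hx ↦ mem_closedBall_zero_iff.1 (hu x hx)

theorem exists_le_supSeminorm [ContinuousConstSMul 𝕜 V] {p : Seminorm 𝕜 (V →L[𝕜] 𝕜)}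
    (hp : Continuous p) :
    ∃ (B : Set V) (hB : Bornology.IsVonNBounded 𝕜 B), p ≤ supSeminorm B hB := by
  have hp₁ : p.ball 0 1 ∈ nhds (0 : V →L[𝕜] 𝕜) := by
    rw [p.ball_zero_eq]
    exact (hp.tendsto' 0 0 (map_zero p)).eventually (gt_mem_nhds one_pos)
  obtain ⟨⟨B, ε⟩, ⟨hB, hε⟩, hBε⟩ := (ContinuousLinearMap.hasBasis_nhds_zero_of_basis
    (Metric.nhds_basis_closedBall (x := (0 : 𝕜)))).mem_iff.1 hp₁
  have hεB : Bornology.IsVonNBounded 𝕜 ((fun x ↦ (ε⁻¹ : 𝕜) • x) '' B) :=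
    hB.image ((ε⁻¹ : 𝕜) • ContinuousLinearMap.id 𝕜 V)
  refine ⟨_, hεB, fun u ↦ le_of_forall_gt_imp_ge_of_dense fun M hM ↦ ?_⟩
  have hM₀ : 0 < M := (apply_nonneg _ u).trans_lt hM
  have hmem : (M⁻¹ : 𝕜) • u ∈ p.ball 0 1 := by
    refine hBε fun x hx ↦ ?_
    have hux := (norm_apply_le_supSeminorm hεB u (mem_image_of_mem _ hx)).trans hM.le
    rw [map_smul, norm_smul, norm_inv, RCLike.norm_ofReal, abs_of_pos hε, inv_mul_le_iff₀ hε] at hux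
    rwa [mem_closedBall_zero_iff, _root_.smul_apply, norm_smul, norm_inv, RCLike.norm_ofReal,
      abs_of_pos hM₀, inv_mul_le_iff₀ hM₀, mul_comm]
  rw [Seminorm.mem_ball_zero, map_smul_eq_mul, norm_inv, RCLike.norm_ofReal, abs_of_pos hM₀,
    inv_mul_lt_iff₀ hM₀, mul_one] at hmem
  exact hmem.le

/- By the bipolar theorem, `A` lies in the closed absolutely convex hull of `B`; the proof is the
Hahn–Banach argument for that theorem. -/
open scoped Pointwise in
theorem isVonNBounded_of_norm_apply_le_supSeminorm [IsTopologicalAddGroup V] [Module ℝ V]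
    [IsScalarTower ℝ 𝕜 V] [ContinuousSMul 𝕜 V] [LocallyConvexSpace ℝ V] {A : Set V}
    (h : ∀ u : V →L[𝕜] 𝕜, ∀ x ∈ A, ‖u x‖ ≤ supSeminorm B hB u) : Bornology.IsVonNBounded 𝕜 A := by
  have := IsScalarTower.continuousSMul (M := ℝ) (N := 𝕜) (α := V)
  refine (nhds_hasBasis_absConvex_closed ℝ V).isVonNBounded_iff.2 fun s ⟨hs, hs_closed, hs_abs⟩ ↦ ?_
  obtain ⟨r, hr, hBs⟩ := (hB hs).exists_pos
  refine .of_norm ⟨r, fun c hc x hx ↦ ?_⟩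
  have hc₀ : c ≠ 0 := norm_pos_iff.1 (hr.trans_le hc)
  have hcs : Convex ℝ (c • s) :=
    hs_abs.2.linear_image ((LinearMap.lsmul 𝕜 V c).restrictScalars ℝ)
  by_contra hxs
  obtain ⟨u, t, hut, htx⟩ :=
    RCLike.geometric_hahn_banach_closed_point (𝕜 := 𝕜) hcs (hs_closed.smul_of_ne_zero hc₀) hxs
  have ht : 0 ≤ t := by
    simpa only [_root_.map_zero] using (hut 0 ⟨0, mem_of_mem_nhds hs, smul_zero c⟩).le
  have hB_le : ∀ y ∈ B, ‖u y‖ ≤ t := fun y hy ↦ by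
    obtain ⟨z, hz, hzy⟩ := RCLike.exists_norm_eq_mul_self (u y)
    have hz₀ : z ≠ 0 := norm_ne_zero_iff.1 (by rw [hz]; exact one_ne_zero)
    have hy_mem : y ∈ (z⁻¹ * c) • s := hBs _ (by rwa [norm_mul, norm_inv, hz, inv_one, one_mul]) hy
    have hzy_mem : z • y ∈ c • s := by rwa [mul_smul, mem_inv_smul_set_iff₀ hz₀] at hy_mem
    have hre := hut (z • y) hzy_mem
    rw [map_smul, smul_eq_mul, ← hzy, RCLike.ofReal_re] at hre
    exact hre.le
  exact ((htx.trans_le (RCLike.re_le_norm _)).trans_le (h u x hx)).not_ge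
    (supSeminorm_le hB ht hB_le)

end StrongDual

section PowerBounded

variable {V : Type*} [AddCommGroup V] [Module ℂ V] [TopologicalSpace V]

theorem precomp_iterate_apply (S : V →L[ℂ] V) (m : ℕ) (u : V →L[ℂ] ℂ) (x : V) :
    (ContinuousLinearMap.precomp ℂ S)^[m] u x = u (S^[m] x) := by
  induction m generalizing u with
  | zero => rfl
  | succ m ih => rw [iterate_succ_apply, ih, iterate_succ_apply', ContinuousLinearMap.precomp_apply,
      ContinuousLinearMap.comp_apply]

theorem isPowerBounded_precomp_iff [IsTopologicalAddGroup V] [Module ℝ V] [IsScalarTower ℝ ℂ V]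
    [ContinuousSMul ℂ V] [LocallyConvexSpace ℝ V] (S : V →L[ℂ] V) :
    IsPowerBounded (ContinuousLinearMap.precomp ℂ S : (V →L[ℂ] ℂ) →L[ℂ] V →L[ℂ] ℂ) ↔
      ∀ B, Bornology.IsVonNBounded ℂ B → Bornology.IsVonNBounded ℂ (⋃ m, S^[m] '' B) := by
  constructor
  · intro h B hB
    obtain ⟨q, hq, hBq⟩ := h (supSeminorm B hB) (continuous_supSeminorm hB)
    obtain ⟨B', hB', hqB'⟩ := exists_le_supSeminorm hq
    refine isVonNBounded_of_norm_apply_le_supSeminorm hB' fun u y hy ↦ ?_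
    obtain ⟨m, x, hx, rfl⟩ := mem_iUnion.1 hy
    calc ‖u (S^[m] x)‖
        = ‖(ContinuousLinearMap.precomp ℂ S)^[m] u x‖ := by rw [precomp_iterate_apply]
      _ ≤ supSeminorm B hB ((ContinuousLinearMap.precomp ℂ S)^[m] u) :=
        norm_apply_le_supSeminorm hB _ hx
      _ ≤ supSeminorm B' hB' u := (hBq m u).trans (hqB' u)
  · intro h p hp
    obtain ⟨B, hB, hpB⟩ := exists_le_supSeminorm hp
    refine ⟨supSeminorm _ (h B hB), continuous_supSeminorm _, fun m u ↦ (hpB _).trans ?_⟩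
    refine supSeminorm_le hB (apply_nonneg _ _) fun x hx ↦ ?_
    rw [precomp_iterate_apply]
    exact norm_apply_le_supSeminorm (h B hB) u (mem_iUnion.2 ⟨m, mem_image_of_mem _ hx⟩)

end PowerBounded

section SmoothlyBounded

variable {ι κ E F G : Type*} [NormedAddCommGroup E] [NormedSpace ℝ E] [NormedAddCommGroup F]
  [NormedSpace ℝ F] [NormedAddCommGroup G] [NormedSpace ℝ G]

/-- The family of functions `f i` is bounded in `C^∞` along the family of sets `K i`: for each `n`,
the derivatives of order `n` of the `f i` at points of `K i` are bounded uniformly in `i`. No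
smoothness is implied. -/
def IsSmoothlyBounded (K : ι → Set E) (f : ι → E → F) : Prop :=
  ∀ n, ∃ M, ∀ i, ∀ y ∈ K i, ‖iteratedFDeriv ℝ n (f i) y‖ ≤ M

namespace IsSmoothlyBounded

variable {K : ι → Set E} {f : ι → E → F}

theorem exists_forall_le (hf : IsSmoothlyBounded K f) (n : ℕ) :
    ∃ M, 1 ≤ M ∧ ∀ k ≤ n, ∀ i, ∀ y ∈ K i, ‖iteratedFDeriv ℝ k (f i) y‖ ≤ M := by
  choose C hC using hf
  obtain ⟨M, hM⟩ := (insert 1 ((Finset.range (n + 1)).image C)).exists_le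
  refine ⟨M, hM 1 (Finset.mem_insert_self _ _), fun k hk i y hy ↦ (hC k i y hy).trans (hM _ ?_)⟩
  exact Finset.mem_insert_of_mem (Finset.mem_image_of_mem C (Finset.mem_range_succ_iff.2 hk))

theorem comp_index (hf : IsSmoothlyBounded K f) (e : κ → ι) :
    IsSmoothlyBounded (fun j ↦ K (e j)) fun j ↦ f (e j) :=
  fun n ↦ (hf n).imp fun _ hM j ↦ hM (e j)

theorem mono (hf : IsSmoothlyBounded K f) {K' : ι → Set E} (hK : ∀ i, K' i ⊆ K i) :
    IsSmoothlyBounded K' f :=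
  fun n ↦ (hf n).imp fun _ hM i y hy ↦ hM i y (hK i hy)

theorem congr (hf : IsSmoothlyBounded K f) {g : ι → E → F}
    (hfg : ∀ i, ∀ y ∈ K i, g i =ᶠ[nhds y] f i) : IsSmoothlyBounded K g :=
  fun n ↦ (hf n).imp fun _ hM i y hy ↦ by
    rw [((hfg i y hy).iteratedFDeriv ℝ n).eq_of_nhds]
    exact hM i y hy

theorem of_isCompact {V K : Set E} (hV : IsOpen V) (hK : IsCompact K) (hKV : K ⊆ V) {f : E → F}
    (hf : ContDiffOn ℝ ∞ f V) : IsSmoothlyBounded (fun _ : ι ↦ K) fun _ ↦ f := by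
  intro n
  have hcont : ContinuousOn (iteratedFDeriv ℝ n f) K :=
    ((hf.continuousOn_iteratedFDerivWithin (mod_cast le_top) hV.uniqueDiffOn).congr
      fun y hy ↦ (iteratedFDerivWithin_of_isOpen n hV hy).symm).mono hKV
  exact (hK.exists_bound_of_continuousOn hcont).imp fun _ hM _ ↦ hM

theorem comp {V : ι → Set E} {U : ι → Set F} {f : ι → F → G} {g : ι → E → F}
    (hf : IsSmoothlyBounded (fun i ↦ g i '' K i) f) (hg : IsSmoothlyBounded K g)
    (hKV : ∀ i, K i ⊆ V i) (hV : ∀ i, IsOpen (V i)) (hU : ∀ i, IsOpen (U i))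
    (hVU : ∀ i, MapsTo (g i) (V i) (U i)) (hf_smooth : ∀ i, ContDiffOn ℝ ∞ (f i) (U i))
    (hg_smooth : ∀ i, ContDiffOn ℝ ∞ (g i) (V i)) :
    IsSmoothlyBounded K fun i ↦ f i ∘ g i := by
  intro n
  obtain ⟨M, -, hM⟩ := hf.exists_forall_le n
  obtain ⟨D, hD₁, hD⟩ := hg.exists_forall_le n
  refine ⟨n.factorial * M * D ^ n, fun i y hy ↦ ?_⟩
  rw [← iteratedFDerivWithin_of_isOpen n (hV i) (hKV i hy)]
  refine norm_iteratedFDerivWithin_comp_le (hf_smooth i) (hg_smooth i) (mod_cast le_top)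
    (hU i).uniqueDiffOn (hV i).uniqueDiffOn (hVU i) (hKV i hy) (fun k hk ↦ ?_) fun k hk₁ hk ↦ ?_
  · rw [iteratedFDerivWithin_of_isOpen k (hU i) (hVU i (hKV i hy))]
    exact hM k hk i _ (mem_image_of_mem _ hy)
  · rw [iteratedFDerivWithin_of_isOpen k (hV i) (hKV i hy)]
    exact (hD k hk i y hy).trans (le_self_pow₀ hD₁ (Nat.one_le_iff_ne_zero.1 hk₁))

theorem smul {𝕜 : Type*} [RCLike 𝕜] [NormedSpace 𝕜 F] {V : ι → Set E} {a : ι → E → 𝕜}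
    (ha : IsSmoothlyBounded K a) (hf : IsSmoothlyBounded K f) (hKV : ∀ i, K i ⊆ V i)
    (hV : ∀ i, IsOpen (V i)) (ha_smooth : ∀ i, ContDiffOn ℝ ∞ (a i) (V i))
    (hf_smooth : ∀ i, ContDiffOn ℝ ∞ (f i) (V i)) :
    IsSmoothlyBounded K fun i y ↦ a i y • f i y := by
  intro n
  obtain ⟨A, hA₁, hA⟩ := ha.exists_forall_le n
  obtain ⟨M, -, hM⟩ := hf.exists_forall_le n
  refine ⟨∑ k ∈ Finset.range (n + 1), n.choose k * A * M, fun i y hy ↦ ?_⟩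
  rw [← iteratedFDerivWithin_of_isOpen n (hV i) (hKV i hy)]
  refine (norm_iteratedFDerivWithin_smul_le (ha_smooth i) (hf_smooth i) (hV i).uniqueDiffOn
    (hKV i hy) (mod_cast le_top)).trans (Finset.sum_le_sum fun k hk ↦ ?_)
  rw [iteratedFDerivWithin_of_isOpen k (hV i) (hKV i hy),
    iteratedFDerivWithin_of_isOpen (n - k) (hV i) (hKV i hy)]
  gcongr
  · exact hA k (Finset.mem_range_succ_iff.1 hk) i y hy
  · exact hM (n - k) (Nat.sub_le n k) i y hy

end IsSmoothlyBounded

end SmoothlyBounded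

section PartialDerivatives

variable {ι κ E F : Type*} [Fintype κ] [NormedAddCommGroup E] [NormedSpace ℝ E]
  [NormedAddCommGroup F] [NormedSpace ℝ F]

theorem norm_le_sum_norm_apply (x : EuclideanSpace ℝ κ) : ‖x‖ ≤ ∑ c, ‖x c‖ := by
  calc ‖x‖ = ‖∑ c, x c • EuclideanSpace.basisFun κ ℝ c‖ :=
        congrArg norm ((EuclideanSpace.basisFun κ ℝ).sum_repr x).symm
    _ ≤ ∑ c, ‖x c • EuclideanSpace.basisFun κ ℝ c‖ := norm_sum_le _ _
    _ = ∑ c, ‖x c‖ := Finset.sum_congr rfl fun c _ ↦ by simp [norm_smul]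

theorem norm_iteratedFDeriv_le_sum_components {g : E → EuclideanSpace ℝ κ} {y : E} {n : ℕ}
    (hg : ContDiffAt ℝ n g y) :
    ‖iteratedFDeriv ℝ n g y‖ ≤ ∑ c, ‖iteratedFDeriv ℝ n (fun z ↦ g z c) y‖ := by
  refine ContinuousMultilinearMap.opNorm_le_bound (Finset.sum_nonneg fun _ _ ↦ norm_nonneg _)
    fun v ↦ (norm_le_sum_norm_apply _).trans ?_
  rw [Finset.sum_mul]
  refine Finset.sum_le_sum fun c _ ↦ ?_
  have hproj : iteratedFDeriv ℝ n (fun z ↦ g z c) y v = iteratedFDeriv ℝ n g y v c :=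
    congrArg (· v) ((EuclideanSpace.proj c : EuclideanSpace ℝ κ →L[ℝ] ℝ).iteratedFDeriv_comp_left
      hg le_rfl)
  rw [← hproj]
  exact ContinuousMultilinearMap.le_opNorm _ _

theorem IsSmoothlyBounded.of_components {K : ι → Set E} {g : ι → E → EuclideanSpace ℝ κ}
    (hg : ∀ c, IsSmoothlyBounded K fun i y ↦ g i y c)
    (hg_smooth : ∀ i, ∀ y ∈ K i, ContDiffAt ℝ ∞ (g i) y) : IsSmoothlyBounded K g := by
  intro n
  choose M hM using fun c ↦ hg c n
  exact ⟨∑ c, M c, fun i y hy ↦ (norm_iteratedFDeriv_le_sum_components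
    ((hg_smooth i y hy).of_le (mod_cast le_top))).trans (Finset.sum_le_sum fun c _ ↦ hM c i y hy)⟩

theorem norm_le_sum_norm_apply_single [DecidableEq κ] {n : ℕ} (T : EuclideanSpace ℝ κ [×n]→L[ℝ] F) :
    ‖T‖ ≤ ∑ β : Fin n → κ, ‖T fun i ↦ EuclideanSpace.single (β i) (1 : ℝ)‖ := by
  refine T.opNorm_le_bound (Finset.sum_nonneg fun _ _ ↦ norm_nonneg _) fun v ↦ ?_
  have hv : v = fun i ↦ ∑ c, v i c • EuclideanSpace.single c (1 : ℝ) := by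
    ext i : 1
    simpa using ((EuclideanSpace.basisFun κ ℝ).sum_repr (v i)).symm
  conv_lhs => rw [hv]
  rw [← T.coe_coe, MultilinearMap.map_sum, Finset.sum_mul]
  refine (norm_sum_le _ _).trans (Finset.sum_le_sum fun β _ ↦ ?_)
  rw [MultilinearMap.map_smul_univ, norm_smul, mul_comm, norm_prod]
  gcongr with i
  exact PiLp.norm_apply_le (v i) (β i)

theorem iSup_cnSeminorm_lt_top_iff {d : ℕ} {K : ι → Set (EuclideanSpace ℝ (Fin d))}
    {f : ι → EuclideanSpace ℝ (Fin d) → F} :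
    (∀ n, ⨆ i, cnSeminorm n (K i) (f i) < ⊤) ↔ IsSmoothlyBounded K f := by
  constructor
  · intro h n
    refine ⟨∑ _β : Fin n → Fin d, (⨆ i, cnSeminorm n (K i) (f i)).toReal, fun i y hy ↦
      (norm_le_sum_norm_apply_single _).trans (Finset.sum_le_sum fun β _ ↦ ?_)⟩
    rw [← toReal_enorm]
    refine ENNReal.toReal_mono (h n).ne (le_trans ?_ (le_iSup _ i))
    exact le_iSup₂_of_le n le_rfl (le_iSup_of_le β (le_iSup₂_of_le y hy le_rfl))
  · intro h n
    obtain ⟨M, -, hM⟩ := h.exists_forall_le n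
    refine (iSup_le fun i ↦ ?_).trans_lt (ENNReal.ofReal_lt_top (r := M))
    refine iSup₂_le fun k hk ↦ iSup_le fun β ↦ iSup₂_le fun y hy ↦ ?_
    rw [← ofReal_norm]
    refine ENNReal.ofReal_le_ofReal (le_trans ?_ (hM k hk i y hy))
    simpa using (iteratedFDeriv ℝ k (f i) y).le_opNorm fun j ↦ EuclideanSpace.single (β j) (1 : ℝ)

end PartialDerivatives

section TestFunctions

variable {ι 𝕜 E F : Type*} [RCLike 𝕜] [NormedAddCommGroup E] [NormedSpace ℝ E]
  [NormedAddCommGroup F] [NormedSpace ℝ F] [NormedSpace 𝕜 F] [IsScalarTower ℝ 𝕜 F]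
  {X : Opens E}

instance : ContinuousSMul 𝕜 𝓓(X, F) := by
  have continuous_I_smul : Continuous fun f : 𝓓(X, F) ↦ (RCLike.I : 𝕜) • f :=
    (TestFunction.mkCLM 𝕜 ((RCLike.I : 𝕜) • ·) (smul_add _) (smul_comm _) fun K hK ↦
      (TestFunction.continuous_ofSupportedIn hK).comp
        (continuous_const_smul (RCLike.I : 𝕜) : Continuous fun f : 𝓓_{K}(E, F) ↦ _)).continuous
  have smul_eq (a : 𝕜) (f : 𝓓(X, F)) :
      a • f = RCLike.re a • f + RCLike.im a • (RCLike.I : 𝕜) • f := by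
    rw [← smul_assoc, RCLike.real_smul_eq_coe_mul, ← algebraMap_smul 𝕜 (RCLike.re a) f, ← add_smul]
    exact congrArg (· • f) (RCLike.re_add_im a).symm
  refine ⟨(?_ : Continuous fun p : 𝕜 × 𝓓(X, F) ↦ p.1 • p.2)⟩
  rw [funext fun p : 𝕜 × 𝓓(X, F) ↦ smul_eq p.1 p.2]
  exact ((RCLike.continuous_re.comp continuous_fst).smul continuous_snd).add
    ((RCLike.continuous_im.comp continuous_fst).smul (continuous_I_smul.comp continuous_snd))

theorem IsSmoothlyBounded.univ_of_tsupport_subset {K : ι → Set E} {f : ι → E → F}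
    (hf : IsSmoothlyBounded K f) (hsupp : ∀ i, tsupport (f i) ⊆ K i) :
    IsSmoothlyBounded (fun _ ↦ univ) f := by
  intro n
  obtain ⟨M, hM⟩ := hf n
  refine ⟨max M 0, fun i y _ ↦ ?_⟩
  by_cases hy : iteratedFDeriv ℝ n (f i) y = 0
  · rw [hy, norm_zero]
    exact le_max_right _ _
  · exact (hM i y (hsupp i (support_iteratedFDeriv_subset n hy))).trans (le_max_left _ _)

theorem IsSmoothlyBounded.of_hasCompactSupport {f : E → F} (hf : ContDiff ℝ ∞ f)
    (hf_supp : HasCompactSupport f) : IsSmoothlyBounded (fun _ : ι ↦ univ) fun _ ↦ f :=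
  (of_isCompact isOpen_univ hf_supp (subset_univ _) hf.contDiffOn).univ_of_tsupport_subset
    fun _ ↦ subset_rfl

variable (𝕜) in
theorem isVonNBounded_range_of_isSmoothlyBounded {K : Compacts E} (hK : (K : Set E) ⊆ X)
    {f : ι → 𝓓(X, F)} (hsupp : ∀ i, tsupport (f i) ⊆ K)
    (hf : IsSmoothlyBounded (fun _ ↦ univ) fun i ↦ ⇑(f i)) :
    Bornology.IsVonNBounded 𝕜 (range f) := by
  let g (i : ι) : 𝓓_{K}(E, F) :=
    .of_support_subset (f i).contDiff (subset_closure.trans (hsupp i))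
  have hg : Bornology.IsVonNBounded 𝕜 (range g) := by
    rw [(ContDiffMapSupportedIn.withSeminorms 𝕜 E F ⊤ K).isVonNBounded_iff_seminorm_bounded]
    intro n
    obtain ⟨M, hM₁, hM⟩ := hf.exists_forall_le n
    refine ⟨M + 1, by positivity, forall_mem_range.2 fun i ↦ lt_of_le_of_lt ?_ (lt_add_one _)⟩
    rw [ContDiffMapSupportedIn.seminorm_top_le_iff 𝕜 (by positivity)]
    exact fun x _ ↦ hM n le_rfl i x (mem_univ x)
  refine (hg.image (TestFunction.ofSupportedInCLM 𝕜 hK)).subset ?_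
  rintro _ ⟨i, rfl⟩
  exact ⟨g i, mem_range_self i, rfl⟩

theorem continuous_of_isVonNBounded_image {V : Type*} [AddCommGroup V] [Module ℝ V] [Module 𝕜 V]
    [IsScalarTower ℝ 𝕜 V] [TopologicalSpace V] [IsTopologicalAddGroup V] [ContinuousSMul 𝕜 V]
    [LocallyConvexSpace ℝ V] (L : 𝓓(X, F) →ₗ[𝕜] V)
    (hL : ∀ (K : Compacts E) (B : Set 𝓓(X, F)), (K : Set E) ⊆ X → (∀ f ∈ B, tsupport f ⊆ K) →
      IsSmoothlyBounded (fun _ : B ↦ univ) (fun f : B ↦ ⇑(f : 𝓓(X, F))) →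
        Bornology.IsVonNBounded 𝕜 (L '' B)) : Continuous L := by
  have := IsScalarTower.continuousSMul (M := ℝ) (N := 𝕜) (α := V)
  refine (TestFunction.continuous_iff_continuous_comp L).2 fun K hK ↦ ?_
  have hseminorms := ContDiffMapSupportedIn.withSeminorms 𝕜 E F ⊤ K
  have := hseminorms.firstCountableTopology
  refine LinearMap.continuous_of_locally_bounded
    (L ∘ₗ (TestFunction.ofSupportedInCLM 𝕜 hK).toLinearMap) fun s hs ↦ ?_
  rw [LinearMap.coe_comp, image_comp]
  refine hL K _ hK ?_ fun n ↦ ?_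
  · rintro _ ⟨f, -, rfl⟩
    exact f.tsupport_subset
  · obtain ⟨M, -, hM⟩ := hseminorms.isVonNBounded_iff_seminorm_bounded.1 hs n
    refine ⟨M, ?_⟩
    rintro ⟨_, f, hf, rfl⟩ x -
    exact (ContDiffMapSupportedIn.norm_iteratedFDeriv_apply_le_seminorm_top 𝕜).trans (hM f hf).le

theorem exists_norm_apply_le_of_isVonNBounded {G : Type*} [NormedAddCommGroup G] [NormedSpace ℝ G]
    (T : ι → 𝓓(X, F) →ₗ[ℝ] G)
    (hT : ∀ (K : Compacts E) (B : Set 𝓓(X, F)), (K : Set E) ⊆ X → (∀ f ∈ B, tsupport f ⊆ K) →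
      IsSmoothlyBounded (fun _ : B ↦ univ) (fun f : B ↦ ⇑(f : 𝓓(X, F))) →
        ∃ M, ∀ i, ∀ f ∈ B, ‖T i f‖ ≤ M)
    {B : Set 𝓓(X, F)} (hB : Bornology.IsVonNBounded ℝ B) : ∃ M, ∀ i, ∀ f ∈ B, ‖T i f‖ ≤ M := by
  have hT_memℓp (f : 𝓓(X, F)) : Memℓp (fun i ↦ T i f) ∞ := by
    have hf : IsSmoothlyBounded (fun _ : ({f} : Set 𝓓(X, F)) ↦ univ) fun g ↦ ⇑(g : 𝓓(X, F)) :=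
      (IsSmoothlyBounded.of_hasCompactSupport f.contDiff f.hasCompactSupport).congr
        fun g y _ ↦ by rw [mem_singleton_iff.1 g.2]
    obtain ⟨M, hM⟩ := hT ⟨tsupport f, f.hasCompactSupport⟩ {f} f.tsupport_subset
      (forall_eq.2 subset_rfl) hf
    exact memℓp_infty ⟨M, forall_mem_range.2 fun i ↦ hM i f rfl⟩
  let L : 𝓓(X, F) →ₗ[ℝ] lp (fun _ : ι ↦ G) ∞ :=
    { toFun f := ⟨fun i ↦ T i f, hT_memℓp f⟩
      map_add' f g := by ext i; exact map_add (T i) f g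
      map_smul' a f := by ext i; exact map_smul (T i) a f }
  have hL : Continuous L := continuous_of_isVonNBounded_image L fun K B' hK hsupp hB' ↦ by
    obtain ⟨M, hM⟩ := hT K B' hK hsupp hB'
    exact (NormedSpace.image_isVonNBounded_iff ℝ).2 ⟨max M 0, fun f hf ↦
      lp.norm_le_of_forall_le (le_max_right _ _) fun i ↦ (hM i f hf).trans (le_max_left _ _)⟩
  obtain ⟨M, hM⟩ := (NormedSpace.image_isVonNBounded_iff ℝ).1
    (hB.image (⟨L, hL⟩ : 𝓓(X, F) →L[ℝ] lp (fun _ : ι ↦ G) ∞))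
  exact ⟨M, fun i f hf ↦ (lp.norm_apply_le_norm ENNReal.top_ne_zero (L f) i).trans (hM f hf)⟩

theorem isSmoothlyBounded_of_isVonNBounded {B : Set 𝓓(X, F)} (hB : Bornology.IsVonNBounded ℝ B) :
    IsSmoothlyBounded (fun _ : B ↦ univ) fun f ↦ ⇑(f : 𝓓(X, F)) := by
  intro n
  have contDiffAt (f : 𝓓(X, F)) (x : E) : ContDiffAt ℝ n f x :=
    (f.contDiff.of_le (mod_cast le_top)).contDiffAt
  let T (x : E) : 𝓓(X, F) →ₗ[ℝ] E [×n]→L[ℝ] F :=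
    { toFun f := iteratedFDeriv ℝ n f x
      map_add' f g := iteratedFDeriv_add_apply (contDiffAt f x) (contDiffAt g x)
      map_smul' a f := iteratedFDeriv_const_smul_apply (contDiffAt f x) }
  obtain ⟨M, hM⟩ := exists_norm_apply_le_of_isVonNBounded T (fun K B' _ _ hB' ↦
    (hB' n).imp fun M hM x f hf ↦ hM ⟨f, hf⟩ x (mem_univ x)) hB
  exact ⟨M, fun f x _ ↦ hM x f f.2⟩

theorem exists_compact_exhaustion [FiniteDimensional ℝ E] (X : Opens E) :
    ∃ K : ℕ → Compacts E, (∀ n, (K n : Set E) ⊆ X) ∧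
      ∀ L : Set E, IsCompact L → L ⊆ X → ∃ N, ∀ n ≥ N, L ⊆ K n := by
  have : LocallyCompactSpace X := X.isOpen.isOpenEmbedding_subtypeVal.locallyCompactSpace
  let e : CompactExhaustion X := default
  refine ⟨fun n ↦ ⟨(↑) '' e n, (e.isCompact n).image continuous_subtype_val⟩, fun n ↦
    Subtype.coe_image_subset _ _, fun L hL hLX ↦ ?_⟩
  obtain ⟨N, hN⟩ := e.exists_superset_of_isCompact
    (Topology.IsInducing.subtypeVal.isCompact_preimage_iff (by simpa using hLX) |>.2 hL)
  exact ⟨N, fun n hn x hx ↦ ⟨⟨x, hLX hx⟩, e.subset hn (hN hx), rfl⟩⟩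

/- Otherwise there are `f n ∈ B` and points `x n` leaving every compact subset of `X` such that
`f n (x n) ≠ 0`; but then the functionals `f ↦ n / ‖f n (x n)‖ • f (x n)` are a locally finite
family, which is not bounded on `B`. -/
theorem exists_compact_tsupport_subset_of_isVonNBounded [FiniteDimensional ℝ E] {B : Set 𝓓(X, F)}
    (hB : Bornology.IsVonNBounded ℝ B) :
    ∃ K : Compacts E, (K : Set E) ⊆ X ∧ ∀ f ∈ B, tsupport f ⊆ K := by
  by_contra! hcon
  obtain ⟨K, hKX, hK⟩ := exists_compact_exhaustion X
  have exists_ne_zero (n : ℕ) : ∃ f ∈ B, ∃ x ∉ K n, f x ≠ 0 := by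
    obtain ⟨f, hf, hfK⟩ := hcon (K n) (hKX n)
    by_contra! h
    exact hfK (closure_minimal (fun x hx ↦ not_imp_comm.1 (h f hf x) hx) (K n).isCompact.isClosed)
  choose f hf x hxK hfx using exists_ne_zero
  let T (n : ℕ) : 𝓓(X, F) →ₗ[ℝ] F :=
    { toFun g := (n / ‖f n (x n)‖) • g (x n)
      map_add' g h := smul_add _ _ _
      map_smul' a g := smul_comm _ _ _ }
  have norm_T_apply (n : ℕ) (g : 𝓓(X, F)) : ‖T n g‖ = n / ‖f n (x n)‖ * ‖g (x n)‖ :=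
    (norm_smul _ _).trans (by rw [Real.norm_of_nonneg (by positivity)])
  obtain ⟨M, hM⟩ := exists_norm_apply_le_of_isVonNBounded T (fun L B' hLX hsupp hB' ↦ by
    obtain ⟨N, hN⟩ := hK L L.isCompact hLX
    obtain ⟨M, hM₁, hM⟩ := hB'.exists_forall_le 0
    refine ⟨∑ n ∈ Finset.range N, (n : ℝ) / ‖f n (x n)‖ * M, fun n g hg ↦ ?_⟩
    by_cases hn : n < N
    · refine le_trans ?_ (Finset.single_le_sum (fun i _ ↦ by positivity) (Finset.mem_range.2 hn))
      have hgM := hM 0 le_rfl ⟨g, hg⟩ (x n) (mem_univ _)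
      rw [norm_iteratedFDeriv_zero] at hgM
      rw [norm_T_apply]
      gcongr
    · have hgx : g (x n) = 0 :=
        image_eq_zero_of_notMem_tsupport fun hx ↦ hxK n (hN n (not_lt.1 hn) (hsupp g hg hx))
      rw [norm_T_apply, hgx, norm_zero, mul_zero]
      positivity) hB
  obtain ⟨n, hn⟩ := exists_nat_gt M
  have hnM := hM n (f n) (hf n)
  rw [norm_T_apply, div_mul_cancel₀ _ (norm_ne_zero_iff.2 (hfx n))] at hnM
  exact hn.not_ge hnM

theorem isVonNBounded_range_iff [FiniteDimensional ℝ E] {f : ι → 𝓓(X, F)} :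
    Bornology.IsVonNBounded 𝕜 (range f) ↔
      (∃ K : Compacts E, (K : Set E) ⊆ X ∧ ∀ i, tsupport (f i) ⊆ K) ∧
        IsSmoothlyBounded (fun _ ↦ univ) fun i ↦ ⇑(f i) := by
  refine ⟨fun h ↦ ?_, fun ⟨⟨K, hK, hsupp⟩, hf⟩ ↦
    isVonNBounded_range_of_isSmoothlyBounded 𝕜 hK hsupp hf⟩
  have h_real : Bornology.IsVonNBounded ℝ (range f) := h.restrict_scalars ℝ
  refine ⟨?_, (isSmoothlyBounded_of_isVonNBounded h_real).comp_index (rangeFactorization f)⟩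
  simpa only [forall_mem_range] using exists_compact_tsupport_subset_of_isVonNBounded h_real

end TestFunctions

section Jets

variable {𝕜 E F : Type*} [RCLike 𝕜] [NormedAddCommGroup E] [NormedSpace ℝ E]
  [NormedAddCommGroup F] [NormedSpace ℝ F] [NormedSpace 𝕜 F] [IsScalarTower ℝ 𝕜 F]

theorem norm_iteratedFDeriv_sub_le {f : E → F} (hf : ContDiff ℝ ∞ f) {k : ℕ} {M : ℝ}
    (hM : ∀ x, ‖iteratedFDeriv ℝ (k + 1) f x‖ ≤ M) (x y : E) :
    ‖iteratedFDeriv ℝ k f x - iteratedFDeriv ℝ k f y‖ ≤ M * ‖x - y‖ :=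
  convex_univ.norm_image_sub_le_of_norm_fderiv_le (𝕜 := ℝ)
    (fun z _ ↦ (hf.differentiable_iteratedFDeriv (mod_cast WithTop.coe_lt_top _)) z)
    (fun z _ ↦ norm_fderiv_iteratedFDeriv.trans_le (hM z)) (mem_univ y) (mem_univ x)

variable (E F) in
/-- The Banach space of bounded families of `k`-linear maps indexed by `k ≤ n` and by the points of
`E`; all derivatives of order at most `n` of a function form such a family. -/
abbrev JetSpace (n : ℕ) : Type _ :=
  lp (fun p : Fin (n + 1) × E ↦ E [×(p.1 : ℕ)]→L[ℝ] F) ∞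

/-- The family of all derivatives of order at most `n` of a compactly supported
smooth function. -/
noncomputable def jet (n : ℕ) (f : E → F) (hf : ContDiff ℝ ∞ f) (hf_supp : HasCompactSupport f) :
    JetSpace E F n :=
  ⟨fun p ↦ iteratedFDeriv ℝ p.1 f p.2, by
    obtain ⟨M, -, hM⟩ := (IsSmoothlyBounded.of_hasCompactSupport hf hf_supp).exists_forall_le n
    exact memℓp_infty ⟨M, forall_mem_range.2 fun p ↦ hM p.1 p.1.is_le () p.2 (mem_univ _)⟩⟩

theorem norm_iteratedFDeriv_le_norm_jet {n : ℕ} {f : E → F} (hf : ContDiff ℝ ∞ f)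
    (hf_supp : HasCompactSupport f) {k : ℕ} (hk : k ≤ n) (x : E) :
    ‖iteratedFDeriv ℝ k f x‖ ≤ ‖jet n f hf hf_supp‖ :=
  lp.norm_apply_le_norm ENNReal.top_ne_zero (jet n f hf hf_supp) ⟨⟨k, Nat.lt_succ_of_le hk⟩, x⟩

theorem continuous_jet_comp_sub (n : ℕ) {f : E → F} (hf : ContDiff ℝ ∞ f)
    (hf_supp : HasCompactSupport f) :
    Continuous fun a : E ↦ jet n (fun x ↦ f (x - a)) (hf.comp (contDiff_id.sub contDiff_const))
      (hf_supp.comp_homeomorph (Homeomorph.subRight a)) := by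
  obtain ⟨M, hM₁, hM⟩ :=
    (IsSmoothlyBounded.of_hasCompactSupport hf hf_supp).exists_forall_le (n + 1)
  refine (LipschitzWith.of_dist_le_mul (K := ⟨M, by positivity⟩) fun a b ↦ ?_).continuous
  rw [dist_eq_norm]
  refine lp.norm_le_of_forall_le (by positivity) fun p ↦ ?_
  change ‖iteratedFDeriv ℝ p.1 (fun x ↦ f (x - a)) p.2 -
    iteratedFDeriv ℝ p.1 (fun x ↦ f (x - b)) p.2‖ ≤ _
  rw [iteratedFDeriv_comp_sub, iteratedFDeriv_comp_sub]
  refine (norm_iteratedFDeriv_sub_le hf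
    (fun x ↦ hM _ (Nat.succ_le_succ p.1.is_le) () x (mem_univ x)) _ _).trans_eq ?_
  rw [sub_sub_sub_cancel_left, norm_sub_rev, dist_eq_norm]
  rfl

theorem iteratedFDeriv_convolution_lsmul [FiniteDimensional ℝ E] [MeasurableSpace E] [BorelSpace E]
    (μ : Measure E) [μ.IsAddHaarMeasure] {φ : E → 𝕜} (hφ : LocallyIntegrable φ μ) {f : E → F}
    (hf : ContDiff ℝ ∞ f) (hf_supp : HasCompactSupport f) (k : ℕ) :
    iteratedFDeriv ℝ k (convolution φ f (.lsmul ℝ 𝕜) μ) =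
      convolution φ (iteratedFDeriv ℝ k f) (.lsmul ℝ 𝕜) μ := by
  induction k with
  | zero =>
    simp_rw [iteratedFDeriv_zero_eq_comp]
    ext1 x
    exact ((continuousMultilinearCurryFin0 ℝ E F).symm.toContinuousLinearEquiv.integral_comp_comm
      _).symm
  | succ k ih =>
    have hk : ContDiff ℝ 1 (iteratedFDeriv ℝ k f) :=
      hf.iteratedFDeriv_right (m := 1) (mod_cast le_top)
    ext1 x
    rw [iteratedFDeriv_succ_eq_comp_left, ih, comp_apply,
      ((hf_supp.iteratedFDeriv k).hasFDerivAt_convolution_right _ hφ hk x).fderiv]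
    simp_rw [iteratedFDeriv_succ_eq_comp_left, convolution_def]
    exact (ContinuousLinearEquiv.integral_comp_comm (𝕜 := ℝ) (μ := μ)
      (E := E →L[ℝ] E [×k]→L[ℝ] F) (F := E [×(k + 1)]→L[ℝ] F)
      (continuousMultilinearCurryLeftEquiv ℝ (fun _ ↦ E) F).symm.toContinuousLinearEquiv _).symm

variable [CompleteSpace F]

theorem integral_smul_jet_comp_sub [FiniteDimensional ℝ E] [MeasurableSpace E]
    [BorelSpace E] (μ : Measure E) [μ.IsAddHaarMeasure] (n : ℕ) {φ : E → 𝕜} (hφ : Continuous φ)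
    (hφ_supp : HasCompactSupport φ) {f : E → F} (hf : ContDiff ℝ ∞ f)
    (hf_supp : HasCompactSupport f) :
    ∫ a, φ a • jet n (fun x ↦ f (x - a)) (hf.comp (contDiff_id.sub contDiff_const))
        (hf_supp.comp_homeomorph (Homeomorph.subRight a)) ∂μ =
      jet n (convolution φ f (.lsmul ℝ 𝕜) μ)
        (hf_supp.contDiff_convolution_right _ hφ.locallyIntegrable hf)
        (hφ_supp.convolution _ hf_supp) := by
  ext1
  funext p
  have hint := (hφ.smul (continuous_jet_comp_sub n hf hf_supp)).integrable_of_hasCompactSupport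
    (μ := μ) hφ_supp.smul_right
  refine ((lp.evalCLM 𝕜 _ ∞ p).integral_comp_comm hint).symm.trans ?_
  refine Eq.trans ?_ (congrFun (iteratedFDeriv_convolution_lsmul μ hφ.locallyIntegrable hf hf_supp
    p.1) p.2).symm
  refine integral_congr_ae (.of_forall fun a ↦ ?_)
  exact congrArg (fun T : E [×(p.1 : ℕ)]→L[ℝ] F ↦ φ a • T) (iteratedFDeriv_comp_sub _ _ _)

theorem norm_jet_normed_convolution_sub_le [FiniteDimensional ℝ E] [MeasurableSpace E]
    [BorelSpace E]
    (μ : Measure E) [μ.IsAddHaarMeasure] {n : ℕ} {f : E → F} (hf : ContDiff ℝ ∞ f)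
    (hf_supp : HasCompactSupport f) {M : ℝ}
    (hM : ∀ k ≤ n + 1, ∀ x, ‖iteratedFDeriv ℝ k f x‖ ≤ M) (ρ : ContDiffBump (0 : E)) :
    ‖jet n (convolution (ρ.normed μ) f (.lsmul ℝ ℝ) μ)
        (hf_supp.contDiff_convolution_right _ ρ.continuous_normed.locallyIntegrable hf)
        (ρ.hasCompactSupport_normed.convolution _ hf_supp) - jet n f hf hf_supp‖ ≤
      M * ρ.rOut := by
  have hM₀ : 0 ≤ M := (norm_nonneg _).trans (hM 0 (Nat.zero_le _) 0)
  refine lp.norm_le_of_forall_le (mul_nonneg hM₀ ρ.rOut_pos.le) fun p ↦ ?_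
  change ‖iteratedFDeriv ℝ p.1 (convolution (ρ.normed μ) f _ μ) p.2 -
    iteratedFDeriv ℝ p.1 f p.2‖ ≤ _
  rw [iteratedFDeriv_convolution_lsmul μ ρ.continuous_normed.locallyIntegrable hf hf_supp,
    ← dist_eq_norm]
  have hcont := hf.continuous_iteratedFDeriv (m := p.1) (mod_cast le_top)
  refine ρ.dist_normed_convolution_le hcont.aestronglyMeasurable fun y hy ↦ ?_
  rw [dist_eq_norm]
  refine (norm_iteratedFDeriv_sub_le hf (hM _ (Nat.succ_le_succ p.1.is_le)) y p.2).trans ?_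
  gcongr
  exact (mem_ball_iff_norm.1 hy).le

end Jets

theorem exists_clm_comp_eq {𝕜 V Y : Type*} [RCLike 𝕜] [AddCommGroup V] [Module 𝕜 V]
    [NormedAddCommGroup Y] [NormedSpace 𝕜 Y] (J : V →ₗ[𝕜] Y) (u : V →ₗ[𝕜] 𝕜) (C : ℝ)
    (h : ∀ f, ‖u f‖ ≤ C * ‖J f‖) : ∃ U : Y →L[𝕜] 𝕜, ∀ f, U (J f) = u f := by
  obtain ⟨s, hs⟩ := J.rangeRestrict.exists_rightInverse_of_surjective J.range_rangeRestrict
  have hJs (y : J.range) : J (s y) = y := congrArg Subtype.val (LinearMap.congr_fun hs y)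
  have hus (f : V) : u (s (J.rangeRestrict f)) = u f := by
    have hker := h (s (J.rangeRestrict f) - f)
    rw [map_sub, map_sub, show J (s (J.rangeRestrict f)) = J f from hJs _, sub_self, norm_zero,
      mul_zero] at hker
    exact sub_eq_zero.1 (norm_le_zero_iff.1 hker)
  obtain ⟨U, hU, -⟩ := exists_extension_norm_eq J.range
    ((u ∘ₗ s).mkContinuous C fun y ↦ (h (s y)).trans_eq (by rw [hJs]; rfl))
  exact ⟨U, fun f ↦ (hU (J.rangeRestrict f)).trans (hus f)⟩

section JetFactorization

open ContDiffMapSupportedIn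

variable {𝕜 E F : Type*} [RCLike 𝕜] [NormedAddCommGroup E] [NormedSpace ℝ E]
  [NormedAddCommGroup F] [NormedSpace ℝ F] [NormedSpace 𝕜 F] [IsScalarTower ℝ 𝕜 F] {X : Opens E}

variable (𝕜 F) in
/-- `jet n` as a linear map on the smooth functions supported in `K`. -/
noncomputable def jetLM (n : ℕ) (K : Compacts E) : 𝓓_{K}(E, F) →ₗ[𝕜] JetSpace E F n where
  toFun f := jet n f f.contDiff f.hasCompactSupport
  map_add' f g := by
    ext1
    funext p
    exact iteratedFDeriv_add_apply (f.contDiff.of_le (mod_cast le_top)).contDiffAt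
      (g.contDiff.of_le (mod_cast le_top)).contDiffAt
  map_smul' a f := by
    ext1
    funext p
    exact iteratedFDeriv_const_smul_apply (f.contDiff.of_le (mod_cast le_top)).contDiffAt

theorem exists_clm_jet_eq (u : 𝓓(X, F) →L[𝕜] 𝕜) {K : Compacts E} (hK : (K : Set E) ⊆ X) :
    ∃ (n : ℕ) (U : JetSpace E F n →L[𝕜] 𝕜), ∀ f : 𝓓(X, F), tsupport f ⊆ K →
      U (jet n f f.contDiff f.hasCompactSupport) = u f := by
  let v : 𝓓_{K}(E, F) →L[𝕜] 𝕜 := u ∘L TestFunction.ofSupportedInCLM 𝕜 hK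
  obtain ⟨s, C, -, hC⟩ := Seminorm.bound_of_continuous
    (ContDiffMapSupportedIn.withSeminorms 𝕜 E F ⊤ K)
    ((normSeminorm 𝕜 𝕜).comp v.toLinearMap) (continuous_norm.comp v.continuous)
  have hle (f : 𝓓_{K}(E, F)) : s.sup (fun i ↦ N[𝕜]_{K, i}) f ≤ ‖jetLM 𝕜 F (s.sup id) K f‖ :=
    Seminorm.finset_sup_apply_le (norm_nonneg _) fun i hi ↦
      (ContDiffMapSupportedIn.seminorm_top_le_iff 𝕜 (norm_nonneg _) _ _).2 fun x _ ↦
        norm_iteratedFDeriv_le_norm_jet f.contDiff f.hasCompactSupport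
          (Finset.le_sup (f := id) hi) x
  obtain ⟨U, hU⟩ := exists_clm_comp_eq (jetLM 𝕜 F (s.sup id) K) v.toLinearMap C fun f ↦
    (hC f).trans (mul_le_mul_of_nonneg_left (hle f) C.2)
  exact ⟨s.sup id, U, fun f hf ↦
    hU (.of_support_subset f.contDiff ((subset_tsupport f).trans hf))⟩

end JetFactorization

section Density

variable {d : ℕ} {X : Opens (EuclideanSpace ℝ (Fin d))}

theorem regularDistr_apply {g : EuclideanSpace ℝ (Fin d) → ℂ} (hg : ContinuousOn g X)
    (f : 𝓓(X, ℂ)) : regularDistr X g f = ∫ x, f x * g x :=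
  TestFunction.integralAgainstBilinCLM_eq_integral
    (hg.locallyIntegrableOn X.isOpen.measurableSet)

theorem convolution_lsmul_ofReal_comm {E : Type*} [NormedAddCommGroup E] [MeasurableSpace E]
    [BorelSpace E] (μ : Measure E) [μ.IsAddLeftInvariant] [μ.IsNegInvariant] (f : E → ℂ)
    (ρ : E → ℝ) :
    convolution f (fun x ↦ (ρ x : ℂ)) (.lsmul ℝ ℂ) μ = convolution ρ f (.lsmul ℝ ℝ) μ := by
  rw [← convolution_flip]
  ext1 y
  exact integral_congr_ae (.of_forall fun a ↦ mul_comm _ _)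

/-- With `J_a` the jet of a mollifier centred at `a` and `u = U ∘ jet` on `B`, the value
`∫ f a • U (J_a) = U (∫ f a • J_a)` is `u` of the mollified `f`, so `a ↦ U (J_a)` is the density. -/
theorem exists_regularDistr_approx (u : Distr X) {B : Set 𝓓(X, ℂ)}
    (hB : Bornology.IsVonNBounded ℂ B) {ε : ℝ} (hε : 0 < ε) :
    ∃ g : EuclideanSpace ℝ (Fin d) → ℂ, Continuous g ∧ ∀ f ∈ B, ‖(u - regularDistr X g) f‖ ≤ ε := by
  rw [← Subtype.range_coe (s := B), isVonNBounded_range_iff] at hB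
  obtain ⟨⟨K, hK, hBK⟩, hB⟩ := hB
  obtain ⟨n, U, hU⟩ := exists_clm_jet_eq u hK
  obtain ⟨M, hM₁, hM⟩ := hB.exists_forall_le (n + 1)
  let δ : ℝ := ε / (‖U‖ * M + 1)
  have hδ : 0 < δ := by positivity
  let ρ : ContDiffBump (0 : EuclideanSpace ℝ (Fin d)) := ⟨δ / 2, δ, by positivity, by linarith⟩
  let G : EuclideanSpace ℝ (Fin d) → ℂ := fun x ↦ (ρ.normed volume x : ℂ)
  have hG : ContDiff ℝ ∞ G := Complex.ofRealCLM.contDiff.comp ρ.contDiff_normed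
  have hG_supp : HasCompactSupport G :=
    ρ.hasCompactSupport_normed.comp_left (g := fun x : ℝ ↦ (x : ℂ)) Complex.ofReal_zero
  let j := fun a : EuclideanSpace ℝ (Fin d) ↦ jet n (fun x ↦ G (x - a))
    (hG.comp (contDiff_id.sub contDiff_const)) (hG_supp.comp_homeomorph (Homeomorph.subRight a))
  have hj : Continuous j := continuous_jet_comp_sub n hG hG_supp
  have hg : Continuous fun a ↦ U (j a) := U.continuous.comp hj
  refine ⟨fun a ↦ U (j a), hg, fun f hf ↦ ?_⟩
  have hmollify : regularDistr X (fun a ↦ U (j a)) f =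
      U (jet n (convolution (ρ.normed volume) f (.lsmul ℝ ℝ) volume)
        (f.hasCompactSupport.contDiff_convolution_right _
          ρ.continuous_normed.locallyIntegrable f.contDiff)
        (ρ.hasCompactSupport_normed.convolution _ f.hasCompactSupport)) := by
    have hint : Integrable fun a ↦ f a • j a :=
      (f.continuous.smul hj).integrable_of_hasCompactSupport f.hasCompactSupport.smul_right
    simp_rw [← convolution_lsmul_ofReal_comm]
    rw [regularDistr_apply hg.continuousOn, ← integral_smul_jet_comp_sub volume n f.continuous
      f.hasCompactSupport hG hG_supp, ← U.integral_comp_comm hint]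
    simp only [map_smul, smul_eq_mul]
  change ‖u f - regularDistr X _ f‖ ≤ ε
  rw [hmollify, ← hU f (hBK ⟨f, hf⟩), ← map_sub]
  calc _ ≤ ‖U‖ * (M * δ) := U.le_opNorm_of_le <| by
        rw [norm_sub_rev]
        exact norm_jet_normed_convolution_sub_le volume f.contDiff f.hasCompactSupport
          (fun k hk x ↦ hM k hk ⟨f, hf⟩ x (mem_univ x)) ρ
    _ = ε * (‖U‖ * M / (‖U‖ * M + 1)) := by simp only [δ]; ring
    _ ≤ ε := mul_le_of_le_one_right hε.le (div_le_one_of_le₀ (by linarith) (by positivity))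

theorem eq_of_eq_on_regularDistr {T₁ T₂ : Distr X →L[ℂ] Distr X}
    (h : ∀ g : EuclideanSpace ℝ (Fin d) → ℂ, ContinuousOn g X →
      T₁ (regularDistr X g) = T₂ (regularDistr X g)) : T₁ = T₂ := by
  ext u f
  have hf : Bornology.IsVonNBounded ℂ {f} := Bornology.isVonNBounded_singleton f
  obtain ⟨B, hB, hle⟩ := exists_le_supSeminorm
    (p := (supSeminorm {f} hf).comp (T₁ - T₂).toLinearMap)
    ((continuous_supSeminorm hf).comp (T₁ - T₂).continuous)
  suffices ‖(T₁ - T₂) u f‖ ≤ 0 from sub_eq_zero.1 (norm_le_zero_iff.1 this)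
  refine le_of_forall_pos_le_add fun ε hε ↦ ?_
  obtain ⟨g, hg, hgB⟩ := exists_regularDistr_approx u hB hε
  have hvanish : (T₁ - T₂) (u - regularDistr X g) = (T₁ - T₂) u := by
    rw [map_sub, sub_eq_self]
    exact sub_eq_zero.2 (h g hg.continuousOn)
  calc ‖(T₁ - T₂) u f‖ = ‖(T₁ - T₂) (u - regularDistr X g) f‖ := by rw [hvanish]
    _ ≤ supSeminorm {f} hf ((T₁ - T₂) (u - regularDistr X g)) :=
      norm_apply_le_supSeminorm hf _ (mem_singleton f)
    _ ≤ supSeminorm B hB (u - regularDistr X g) := hle _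
    _ ≤ 0 + ε := by rw [zero_add]; exact supSeminorm_le hB hε.le hgB

end Density

section SmoothEmbedding

variable {E : Type*} [NormedAddCommGroup E] [NormedSpace ℝ E]

/-- Smooth injective maps on the open set `X` whose derivative is everywhere invertible, i.e.
diffeomorphisms of `X` onto an open subset of the same space. The map is total, but only its values
on `X` matter. -/
structure IsSmoothEmbedding (X : Opens E) (Φ : E → E) : Prop where
  contDiffOn : ContDiffOn ℝ ∞ Φ X
  injOn : InjOn Φ X
  det_ne_zero : ∀ x ∈ X, (fderiv ℝ Φ x).det ≠ 0

namespace IsSmoothEmbedding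

variable {X : Opens E} {Φ Ψ : E → E}

theorem contDiffAt (h : IsSmoothEmbedding X Φ) {x : E} (hx : x ∈ X) : ContDiffAt ℝ ∞ Φ x :=
  h.contDiffOn.contDiffAt (X.isOpen.mem_nhds hx)

theorem differentiableAt (h : IsSmoothEmbedding X Φ) {x : E} (hx : x ∈ X) :
    DifferentiableAt ℝ Φ x :=
  (h.contDiffAt hx).differentiableAt (by simp)

theorem isCompact_image (h : IsSmoothEmbedding X Φ) {K : Set E} (hK : IsCompact K) (hKX : K ⊆ X) :
    IsCompact (Φ '' K) :=
  hK.image_of_continuousOn (h.contDiffOn.continuousOn.mono hKX)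

protected theorem id : IsSmoothEmbedding X id :=
  ⟨contDiffOn_id, injOn_id _, fun x _ ↦ by simp [ContinuousLinearMap.det]⟩

theorem comp {Y : Opens E} (hΨ : IsSmoothEmbedding Y Ψ) (hΦ : IsSmoothEmbedding X Φ)
    (hXY : MapsTo Φ X Y) : IsSmoothEmbedding X (Ψ ∘ Φ) := by
  refine ⟨hΨ.contDiffOn.comp hΦ.contDiffOn hXY, hΨ.injOn.comp hΦ.injOn hXY, fun x hx ↦ ?_⟩
  rw [fderiv_comp x (hΨ.differentiableAt (hXY hx)) (hΦ.differentiableAt hx)]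
  exact (LinearMap.det_comp _ _).trans_ne
    (mul_ne_zero (hΨ.det_ne_zero _ (hXY hx)) (hΦ.det_ne_zero _ hx))

theorem iterate (h : IsSmoothEmbedding X Φ) (hΦ : MapsTo Φ X X) (m : ℕ) :
    IsSmoothEmbedding X Φ^[m] := by
  induction m with
  | zero => exact .id
  | succ m ih => exact iterate_succ' Φ m ▸ h.comp ih (hΦ.iterate m)

variable [FiniteDimensional ℝ E]

theorem hasFDerivAt_equiv (h : IsSmoothEmbedding X Φ) {x : E} (hx : x ∈ X) :
    HasFDerivAt Φ ((fderiv ℝ Φ x).toContinuousLinearEquivOfDetNeZero (h.det_ne_zero x hx) :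
      E →L[ℝ] E) x :=
  (h.differentiableAt hx).hasFDerivAt

theorem isOpen_image (h : IsSmoothEmbedding X Φ) {U : Set E} (hU : IsOpen U) (hUX : U ⊆ X) :
    IsOpen (Φ '' U) := by
  rw [isOpen_iff_mem_nhds]
  rintro _ ⟨x, hx, rfl⟩
  rw [← ((h.contDiffAt (hUX hx)).hasStrictFDerivAt' (h.hasFDerivAt_equiv (hUX hx))
    (by simp)).map_nhds_eq_of_equiv]
  exact Filter.image_mem_map (hU.mem_nhds hx)

/-- A smooth embedding of `X` as a homeomorphism of `X` onto its image, with inverse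
`invFunOn Φ X`. -/
noncomputable def toOpenPartialHomeomorph (h : IsSmoothEmbedding X Φ) :
    OpenPartialHomeomorph E E :=
  .ofContinuousOpenRestrict (h.injOn.toPartialEquiv Φ X) h.contDiffOn.continuousOn
    (fun U hU ↦ by
      change IsOpen (Φ ∘ Subtype.val '' U)
      rw [image_comp]
      exact h.isOpen_image (X.isOpen.isOpenMap_subtype_val U hU) (image_subset_iff.2 fun z _ ↦ z.2))
    X.isOpen

theorem contDiffOn_invFunOn (h : IsSmoothEmbedding X Φ) :
    ContDiffOn ℝ ∞ (invFunOn Φ X) (Φ '' X) := by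
  intro y hy
  have hyX : invFunOn Φ X y ∈ X := invFunOn_mem hy
  exact (h.toOpenPartialHomeomorph.contDiffAt_symm hy (h.hasFDerivAt_equiv hyX)
    (h.contDiffAt hyX)).contDiffWithinAt

end IsSmoothEmbedding

theorem contDiff_det [FiniteDimensional ℝ E] : ContDiff ℝ ∞ fun A : E →L[ℝ] E ↦ A.det := by
  let b := Module.finBasis ℝ E
  have hdet (A : E →L[ℝ] E) : A.det = ∑ σ : Equiv.Perm (Fin (Module.finrank ℝ E)),
      (Equiv.Perm.sign σ : ℝ) * ∏ i, b.coord (σ i) (A (b i)) := by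
    refine (LinearMap.det_toMatrix b A.toLinearMap).symm.trans ?_
    simp [Matrix.det_apply', LinearMap.toMatrix_apply]
  simp_rw [hdet]
  exact ContDiff.sum fun σ _ ↦ contDiff_const.mul <| contDiff_prod fun i _ ↦
    ((b.coord (σ i)).toContinuousLinearMap ∘L ContinuousLinearMap.apply ℝ E (b i)).contDiff

end SmoothEmbedding

section WeightedPushforward

variable {α β γ 𝕜 F : Type*} [Nonempty α] [CommSemiring 𝕜] [AddCommMonoid F] [Module 𝕜 F]

/-- The function `(W • f) ∘ Φ⁻¹` on `Φ(X)`, extended by zero. -/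
noncomputable def weightedPushforward (X : Set α) (Φ : α → β) (W : α → 𝕜) (f : α → F) : β → F :=
  indicator (Φ '' X) fun y ↦ W (invFunOn Φ X y) • f (invFunOn Φ X y)

variable {X : Set α} {Φ : α → β} {W : α → 𝕜} {f : α → F}

theorem weightedPushforward_of_mem {y : β} (hy : y ∈ Φ '' X) :
    weightedPushforward X Φ W f y = W (invFunOn Φ X y) • f (invFunOn Φ X y) :=
  indicator_of_mem hy _

theorem weightedPushforward_of_notMem {y : β} (hy : y ∉ Φ '' X) :
    weightedPushforward X Φ W f y = 0 :=
  indicator_of_notMem hy _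

theorem weightedPushforward_apply (hΦ : InjOn Φ X) {x : α} (hx : x ∈ X) :
    weightedPushforward X Φ W f (Φ x) = W x • f x := by
  rw [weightedPushforward_of_mem (mem_image_of_mem Φ hx), hΦ.leftInvOn_invFunOn hx]

theorem weightedPushforward_add (f g : α → F) :
    weightedPushforward X Φ W (f + g) =
      weightedPushforward X Φ W f + weightedPushforward X Φ W g := by
  simp only [weightedPushforward, Pi.add_apply, smul_add]
  exact indicator_add _ _ _

theorem weightedPushforward_smul (c : 𝕜) (f : α → F) :
    weightedPushforward X Φ W (c • f) = c • weightedPushforward X Φ W f := by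
  simp only [weightedPushforward, Pi.smul_apply, smul_comm _ c]
  exact indicator_const_smul _ _ _

attribute [irreducible] weightedPushforward

theorem weightedPushforward_id (hf : support f ⊆ X) :
    weightedPushforward X id (fun _ ↦ (1 : 𝕜)) f = f := by
  ext x
  by_cases hx : x ∈ X
  · exact (weightedPushforward_apply (injOn_id X) hx).trans (one_smul 𝕜 (f x))
  · rw [weightedPushforward_of_notMem (by rwa [image_id]), notMem_support.1 fun hfx ↦ hx (hf hfx)]

theorem weightedPushforward_comp [Nonempty β] {Y : Set β} {Ψ : β → γ} {V : β → 𝕜} (hΨ : InjOn Ψ Y)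
    (hΦ : InjOn Φ X) (hXY : MapsTo Φ X Y) :
    weightedPushforward Y Ψ V (weightedPushforward X Φ W f) =
      weightedPushforward X (Ψ ∘ Φ) (fun x ↦ V (Φ x) * W x) f := by
  ext z
  by_cases hz : z ∈ Ψ '' Y
  · obtain ⟨y, hy, rfl⟩ := hz
    rw [weightedPushforward_apply hΨ hy]
    by_cases hyX : y ∈ Φ '' X
    · obtain ⟨x, hx, rfl⟩ := hyX
      rw [weightedPushforward_apply hΦ hx, ← mul_smul]
      exact (weightedPushforward_apply (W := fun x ↦ V (Φ x) * W x) (hΨ.comp hΦ hXY) hx).symm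
    · rw [weightedPushforward_of_notMem hyX, smul_zero, weightedPushforward_of_notMem]
      rintro ⟨x, hx, hxy⟩
      exact hyX ⟨x, hx, hΨ (hXY hx) hy hxy⟩
  · rw [weightedPushforward_of_notMem hz, weightedPushforward_of_notMem]
    rintro ⟨x, hx, rfl⟩
    exact hz (mem_image_of_mem Ψ (hXY hx))

theorem support_weightedPushforward_subset (hΦ : InjOn Φ X) :
    support (weightedPushforward X Φ W f) ⊆ Φ '' support f := by
  intro y hy
  obtain ⟨x, hx, rfl⟩ : y ∈ Φ '' X := by
    by_contra hyX
    exact hy (weightedPushforward_of_notMem hyX)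
  refine mem_image_of_mem Φ fun hfx ↦ hy ?_
  rw [weightedPushforward_apply hΦ hx, hfx, smul_zero]

end WeightedPushforward

section SmoothPushforward

variable {ι 𝕜 E F : Type*} [RCLike 𝕜] [NormedAddCommGroup E] [NormedSpace ℝ E]
  [NormedAddCommGroup F] [NormedSpace 𝕜 F] {X Y : Opens E} {Φ : E → E} {W : E → 𝕜} {f : E → F}

namespace IsSmoothEmbedding

theorem tsupport_weightedPushforward_subset (h : IsSmoothEmbedding X Φ)
    (hf : HasCompactSupport f) (hfX : tsupport f ⊆ X) :
    tsupport (weightedPushforward X Φ W f) ⊆ Φ '' tsupport f :=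
  closure_minimal ((support_weightedPushforward_subset h.injOn).trans
    (image_mono (subset_tsupport f))) (h.isCompact_image hf hfX).isClosed

theorem hasCompactSupport_weightedPushforward (h : IsSmoothEmbedding X Φ)
    (hf : HasCompactSupport f) (hfX : tsupport f ⊆ X) :
    HasCompactSupport (weightedPushforward X Φ W f) :=
  (h.isCompact_image hf hfX).of_isClosed_subset (isClosed_tsupport _)
    (h.tsupport_weightedPushforward_subset hf hfX)

variable [FiniteDimensional ℝ E]

theorem weightedPushforward_eventuallyEq (h : IsSmoothEmbedding X Φ) {y : E} (hy : y ∈ Φ '' X) :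
    weightedPushforward X Φ W f =ᶠ[nhds y]
      fun z ↦ (W ∘ invFunOn Φ X) z • (f ∘ invFunOn Φ X) z :=
  Filter.mem_of_superset ((h.isOpen_image X.isOpen subset_rfl).mem_nhds hy) fun _ hz ↦
    weightedPushforward_of_mem hz

theorem contDiffOn_comp_invFunOn {G : Type*} [NormedAddCommGroup G] [NormedSpace ℝ G] {g : E → G}
    (h : IsSmoothEmbedding X Φ) (hg : ContDiffOn ℝ ∞ g X) :
    ContDiffOn ℝ ∞ (g ∘ invFunOn Φ X) (Φ '' X) :=
  hg.comp h.contDiffOn_invFunOn fun _ hy ↦ invFunOn_mem hy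

variable [NormedSpace ℝ F] [IsScalarTower ℝ 𝕜 F]

theorem contDiff_weightedPushforward (h : IsSmoothEmbedding X Φ) (hW : ContDiffOn ℝ ∞ W X)
    (hf : ContDiff ℝ ∞ f) (hf_supp : HasCompactSupport f) (hfX : tsupport f ⊆ X) :
    ContDiff ℝ ∞ (weightedPushforward X Φ W f) := by
  refine contDiff_iff_contDiffAt.2 fun y ↦ ?_
  by_cases hy : y ∈ Φ '' X
  · have hyX := (h.isOpen_image X.isOpen subset_rfl).mem_nhds hy
    exact (((h.contDiffOn_comp_invFunOn hW).contDiffAt hyX).smul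
      ((h.contDiffOn_comp_invFunOn hf.contDiffOn).contDiffAt hyX)).congr_of_eventuallyEq
        (h.weightedPushforward_eventuallyEq hy)
  · have hy_supp : y ∉ tsupport (weightedPushforward X Φ W f) := fun hy_supp ↦
      hy (image_mono hfX (h.tsupport_weightedPushforward_subset hf_supp hfX hy_supp))
    exact contDiffAt_const.congr_of_eventuallyEq (notMem_tsupport_iff_eventuallyEq.1 hy_supp)

end IsSmoothEmbedding

variable [FiniteDimensional ℝ E] [NormedSpace ℝ F]

theorem IsSmoothlyBounded.weightedPushforward {Φ : ι → E → E} {W : ι → E → 𝕜} {f : ι → E → F}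
    {K : Set E} (hKX : K ⊆ X) (hΦ : ∀ i, IsSmoothEmbedding X (Φ i))
    (hW_smooth : ∀ i, ContDiffOn ℝ ∞ (W i) X) (hf_smooth : ∀ i, ContDiffOn ℝ ∞ (f i) X)
    (hW : IsSmoothlyBounded (fun i ↦ Φ i '' K) fun i ↦ W i ∘ invFunOn (Φ i) X)
    (hΦ_inv : IsSmoothlyBounded (fun i ↦ Φ i '' K) fun i ↦ invFunOn (Φ i) X)
    (hf : IsSmoothlyBounded (fun _ ↦ K) f) :
    IsSmoothlyBounded (fun i ↦ Φ i '' K) fun i ↦ weightedPushforward X (Φ i) (W i) (f i) := by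
  have hopen (i : ι) : IsOpen (Φ i '' X) := (hΦ i).isOpen_image X.isOpen subset_rfl
  have hsubset (i : ι) : Φ i '' K ⊆ Φ i '' X := image_mono hKX
  have hf_inv : IsSmoothlyBounded (fun i ↦ Φ i '' K) fun i ↦ f i ∘ invFunOn (Φ i) X := by
    refine comp (hf.mono fun i ↦ ?_) hΦ_inv hsubset hopen (fun _ ↦ X.isOpen)
      (fun i y hy ↦ invFunOn_mem hy) hf_smooth fun i ↦ (hΦ i).contDiffOn_invFunOn
    rw [((hΦ i).injOn.leftInvOn_invFunOn.mono hKX).image_image]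
  exact (hW.smul hf_inv hsubset hopen (fun i ↦ (hΦ i).contDiffOn_comp_invFunOn (hW_smooth i))
    fun i ↦ (hΦ i).contDiffOn_comp_invFunOn (hf_smooth i)).congr fun i y hy ↦
      (hΦ i).weightedPushforward_eventuallyEq (hsubset i hy)

variable [IsScalarTower ℝ 𝕜 F]

/-- The linear map `f ↦ (W • f) ∘ Φ⁻¹` from test functions on `X` to test functions on `Y`. -/
noncomputable def pushforwardLM (h : IsSmoothEmbedding X Φ) (hXY : MapsTo Φ X Y)
    (hW : ContDiffOn ℝ ∞ W X) : 𝓓(X, F) →ₗ[𝕜] 𝓓(Y, F) where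
  toFun f := ⟨weightedPushforward X Φ W f,
    h.contDiff_weightedPushforward hW f.contDiff f.hasCompactSupport f.tsupport_subset,
    h.hasCompactSupport_weightedPushforward f.hasCompactSupport f.tsupport_subset,
    (h.tsupport_weightedPushforward_subset f.hasCompactSupport f.tsupport_subset).trans
      (image_subset_iff.2 fun _ hx ↦ hXY (f.tsupport_subset hx))⟩
  map_add' f g := DFunLike.coe_injective (weightedPushforward_add (f : E → F) g)
  map_smul' c f := DFunLike.coe_injective (weightedPushforward_smul c (f : E → F))

/-- The map `pushforwardLM` as a continuous linear operator. -/
noncomputable def pushforwardCLM (h : IsSmoothEmbedding X Φ) (hXY : MapsTo Φ X Y)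
    (hW : ContDiffOn ℝ ∞ W X) : 𝓓(X, F) →L[𝕜] 𝓓(Y, F) where
  toLinearMap := pushforwardLM h hXY hW
  cont := continuous_of_isVonNBounded_image (pushforwardLM h hXY hW) fun K B hKX hsupp hB ↦ by
    rw [image_eq_range]
    have hΦK := h.isCompact_image K.isCompact hKX
    have hΦKY : Φ '' K ⊆ Y := image_subset_iff.2 fun _ hx ↦ hXY (hKX hx)
    have htsupport (f : B) : tsupport (weightedPushforward X Φ W (f : 𝓓(X, F))) ⊆ Φ '' K :=
      (h.tsupport_weightedPushforward_subset f.1.hasCompactSupport f.1.tsupport_subset).trans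
        (image_mono (hsupp f f.2))
    refine isVonNBounded_range_of_isSmoothlyBounded 𝕜 (K := ⟨Φ '' K, hΦK⟩) hΦKY htsupport
      (.univ_of_tsupport_subset ?_ htsupport)
    have hopen := h.isOpen_image X.isOpen subset_rfl
    exact .weightedPushforward hKX (fun _ ↦ h) (fun _ ↦ hW) (fun f ↦ f.1.contDiff.contDiffOn)
      (.of_isCompact hopen hΦK (image_mono hKX) (h.contDiffOn_comp_invFunOn hW))
      (.of_isCompact hopen hΦK (image_mono hKX) h.contDiffOn_invFunOn)
      (hB.mono fun _ ↦ subset_univ _)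

end SmoothPushforward

theorem IsSmoothEmbedding.integral_weightedPushforward_mul {𝕜 E : Type*} [RCLike 𝕜]
    [NormedAddCommGroup E] [NormedSpace ℝ E] [FiniteDimensional ℝ E] [MeasurableSpace E]
    [BorelSpace E] {X : Opens E} {Φ : E → E} (μ : Measure E) [μ.IsAddHaarMeasure]
    (h : IsSmoothEmbedding X Φ) (W f g : E → 𝕜) :
    ∫ y, weightedPushforward X Φ W f y * g y ∂μ =
      ∫ x in X, |(fderiv ℝ Φ x).det| • (W x * f x * g (Φ x)) ∂μ := by
  have hzero : ∀ y ∉ Φ '' X, weightedPushforward X Φ W f y * g y = 0 := fun y hy ↦ by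
    rw [weightedPushforward_of_notMem hy, zero_mul]
  rw [← setIntegral_eq_integral_of_forall_compl_eq_zero hzero,
    integral_image_eq_integral_abs_det_fderiv_smul μ X.isOpen.measurableSet
      (fun x hx ↦ (h.differentiableAt hx).hasFDerivAt.hasFDerivWithinAt) h.injOn]
  refine setIntegral_congr_fun X.isOpen.measurableSet fun x hx ↦ ?_
  simp only [weightedPushforward_apply h.injOn hx, smul_eq_mul]

section Operator

variable {d : ℕ} {X : Opens (EuclideanSpace ℝ (Fin d))} {w : EuclideanSpace ℝ (Fin d) → ℂ}
  {ψ : EuclideanSpace ℝ (Fin d) → EuclideanSpace ℝ (Fin d)}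

/-- The factor `w / |det Jψ|` of the weight products. -/
noncomputable def weightFactor (w : EuclideanSpace ℝ (Fin d) → ℂ)
    (ψ : EuclideanSpace ℝ (Fin d) → EuclideanSpace ℝ (Fin d)) (x : EuclideanSpace ℝ (Fin d)) : ℂ :=
  w x / ((|(fderiv ℝ ψ x).det| : ℝ) : ℂ)

theorem contDiffOn_weightFactor (hψ : IsSmoothEmbedding X ψ) (hw : ContDiffOn ℝ ∞ w X) :
    ContDiffOn ℝ ∞ (weightFactor w ψ) X := by
  have hdet : ContDiffOn ℝ ∞ (fun x ↦ (fderiv ℝ ψ x).det) X :=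
    contDiff_det.comp_contDiffOn (hψ.contDiffOn.fderiv_of_isOpen X.isOpen (by simp))
  have habs : ContDiffOn ℝ ∞ (fun x ↦ |(fderiv ℝ ψ x).det|) X := fun x hx ↦
    ContDiffAt.comp_contDiffWithinAt (g := fun t : ℝ ↦ |t|) x
      (contDiffAt_abs (hψ.det_ne_zero x hx)) (hdet x hx)
  exact (hw.mul ((Complex.ofRealCLM.contDiff.comp_contDiffOn habs).inv fun x hx ↦
    Complex.ofReal_ne_zero.2 (abs_ne_zero.2 (hψ.det_ne_zero x hx)))).congr
      fun x _ ↦ div_eq_mul_inv _ _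

theorem weightProduct_zero : weightProduct w ψ 0 = fun _ ↦ 1 :=
  funext fun _ ↦ Finset.prod_range_zero _

theorem weightProduct_succ (m : ℕ) :
    weightProduct w ψ (m + 1) = fun x ↦ weightFactor w ψ (ψ^[m] x) * weightProduct w ψ m x :=
  funext fun _ ↦ (Finset.prod_range_succ _ _).trans (mul_comm _ _)

theorem contDiffOn_weightProduct (hψ : IsSmoothEmbedding X ψ) (hψ_maps : MapsTo ψ X X)
    (hw : ContDiffOn ℝ ∞ w X) (m : ℕ) : ContDiffOn ℝ ∞ (weightProduct w ψ m) X := by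
  induction m with
  | zero => exact weightProduct_zero ▸ contDiffOn_const
  | succ m ih =>
    rw [weightProduct_succ]
    exact ((contDiffOn_weightFactor hψ hw).comp (hψ.iterate hψ_maps m).contDiffOn
      (hψ_maps.iterate m)).mul ih

/-- The operator `f ↦ (w / |det Jψ| · f) ∘ ψ⁻¹` on test functions, whose transpose is the weighted
composition operator. -/
noncomputable def transferCLM (hψ : IsSmoothEmbedding X ψ) (hψ_maps : MapsTo ψ X X)
    (hw : ContDiffOn ℝ ∞ w X) : 𝓓(X, ℂ) →L[ℂ] 𝓓(X, ℂ) :=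
  pushforwardCLM hψ hψ_maps (contDiffOn_weightFactor hψ hw)

theorem coe_transferCLM (hψ : IsSmoothEmbedding X ψ) (hψ_maps : MapsTo ψ X X)
    (hw : ContDiffOn ℝ ∞ w X) (f : 𝓓(X, ℂ)) :
    ⇑(transferCLM hψ hψ_maps hw f) = weightedPushforward X ψ (weightFactor w ψ) f :=
  rfl

theorem coe_iterate_transferCLM (hψ : IsSmoothEmbedding X ψ) (hψ_maps : MapsTo ψ X X)
    (hw : ContDiffOn ℝ ∞ w X) (m : ℕ) (f : 𝓓(X, ℂ)) :
    ⇑((transferCLM hψ hψ_maps hw)^[m] f) =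
      weightedPushforward X ψ^[m] (weightProduct w ψ m) f := by
  induction m with
  | zero =>
    rw [weightProduct_zero]
    exact (weightedPushforward_id ((subset_tsupport f).trans f.tsupport_subset)).symm
  | succ m ih =>
    rw [iterate_succ_apply', coe_transferCLM, ih, weightedPushforward_comp hψ.injOn
      (hψ.iterate hψ_maps m).injOn (hψ_maps.iterate m), weightProduct_succ, iterate_succ']

/-- The weighted composition operator on distributions, as the transpose of `transferCLM`. -/
noncomputable def weightedCompositionCLM (hψ : IsSmoothEmbedding X ψ) (hψ_maps : MapsTo ψ X X)
    (hw : ContDiffOn ℝ ∞ w X) : Distr X →L[ℂ] Distr X :=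
  ContinuousLinearMap.precomp ℂ (transferCLM hψ hψ_maps hw)

theorem isWeightedCompositionOperator_weightedCompositionCLM (hψ : IsSmoothEmbedding X ψ)
    (hψ_maps : MapsTo ψ X X) (hw : ContDiffOn ℝ ∞ w X) :
    IsWeightedCompositionOperator X w ψ (weightedCompositionCLM hψ hψ_maps hw) := by
  intro g hg
  ext f
  have hcomp : ContinuousOn (fun x ↦ w x * g (ψ x)) X :=
    hw.continuousOn.mul (hg.comp hψ.contDiffOn.continuousOn hψ_maps)
  have hzero : ∀ x ∉ (X : Set (EuclideanSpace ℝ (Fin d))), f x * (w x * g (ψ x)) = 0 :=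
    fun x hx ↦ by
      rw [image_eq_zero_of_notMem_tsupport fun hxf ↦ hx (f.tsupport_subset hxf), zero_mul]
  change regularDistr X g (transferCLM hψ hψ_maps hw f) = _
  rw [regularDistr_apply hg, regularDistr_apply hcomp, coe_transferCLM,
    hψ.integral_weightedPushforward_mul volume,
    ← setIntegral_eq_integral_of_forall_compl_eq_zero hzero]
  refine setIntegral_congr_fun X.isOpen.measurableSet fun x hx ↦ ?_
  have hdet : ((|(fderiv ℝ ψ x).det| : ℝ) : ℂ) ≠ 0 :=
    Complex.ofReal_ne_zero.2 (abs_ne_zero.2 (hψ.det_ne_zero x hx))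
  simp only [weightFactor, Complex.real_smul]
  field_simp

end Operator

section PowerBoundedness

theorem exists_testFunction_eq {E F : Type*} [NormedAddCommGroup E] [NormedSpace ℝ E]
    [FiniteDimensional ℝ E] [NormedAddCommGroup F] [NormedSpace ℝ F] {X : Opens E} {K : Set E}
    (hK : IsCompact K) (hKX : K ⊆ X) (c : F) : ∃ f : 𝓓(X, F), ∀ᶠ x in nhdsSet K, f x = c := by
  obtain ⟨L, hL, hKL, hLX⟩ := exists_compact_between hK X.isOpen hKX
  obtain ⟨g, hg_one, hg_zero, -⟩ := exists_contMDiffMap_one_nhds_of_subset_interior (n := (⊤ : ℕ∞))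
    (modelWithCornersSelf ℝ E) hK.isClosed hKL
  have hsupp : tsupport (fun x ↦ g x • c) ⊆ L :=
    closure_minimal (fun x hx ↦ by_contra fun hxL ↦ hx (by simp [hg_zero x hxL])) hL.isClosed
  refine ⟨⟨fun x ↦ g x • c, g.contMDiff.contDiff.smul contDiff_const,
    hL.of_isClosed_subset (isClosed_tsupport _) hsupp, hsupp.trans hLX⟩, ?_⟩
  filter_upwards [hg_one] with x hx
  exact (congrArg (· • c) hx).trans (one_smul ℝ c)

theorem IsSmoothEmbedding.subset_closure_inter_preimage {E : Type*} [NormedAddCommGroup E]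
    [NormedSpace ℝ E] [FiniteDimensional ℝ E] {X : Opens E} {Φ : E → E}
    (h : IsSmoothEmbedding X Φ) {D : Set E} (hD : Φ '' X ⊆ closure D) :
    (X : Set E) ⊆ closure (X ∩ Φ ⁻¹' D) := by
  intro x hx
  rw [mem_closure_iff]
  intro U hU hxU
  obtain ⟨_, ⟨z, hz, rfl⟩, hzD⟩ := mem_closure_iff.1 (hD (mem_image_of_mem Φ hx)) _
    (h.isOpen_image (hU.inter X.isOpen) inter_subset_right) (mem_image_of_mem Φ ⟨hxU, hx⟩)
  exact ⟨z, hz.1, hz.2, hzD⟩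

theorem IsSmoothEmbedding.image_support_subset_tsupport_weightedPushforward {E 𝕜 F : Type*}
    [NormedAddCommGroup E] [NormedSpace ℝ E] [RCLike 𝕜] [NormedAddCommGroup F] [NormedSpace 𝕜 F]
    {X : Opens E} {Φ : E → E} {W : E → 𝕜} {f : E → F} (h : IsSmoothEmbedding X Φ)
    (hW : (X : Set E) ⊆ closure (X ∩ support W)) (hf : Continuous f) :
    Φ '' (X ∩ support f) ⊆ tsupport (weightedPushforward X Φ W f) := by
  rintro _ ⟨x, ⟨hxX, hxf⟩, rfl⟩
  have hx : x ∈ closure (support f ∩ (X ∩ support W)) :=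
    hf.isOpen_support.inter_closure ⟨hxf, hW hxX⟩
  refine (h.contDiffAt hxX).continuousAt.continuousWithinAt.mem_closure hx ?_
  rintro z ⟨hzf, hzX, hzW⟩
  rw [mem_support, weightedPushforward_apply h.injOn hzX]
  exact smul_ne_zero hzW hzf

variable {d : ℕ} {X : Opens (EuclideanSpace ℝ (Fin d))} {w : EuclideanSpace ℝ (Fin d) → ℂ}
  {ψ : EuclideanSpace ℝ (Fin d) → EuclideanSpace ℝ (Fin d)}

theorem subset_closure_support_weightProduct (hψ : IsSmoothEmbedding X ψ) (hψ_maps : MapsTo ψ X X)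
    (hw : ContDiffOn ℝ ∞ w X)
    (hw_dense : (X : Set (EuclideanSpace ℝ (Fin d))) ⊆ closure {x | x ∈ X ∧ w x ≠ 0}) (m : ℕ) :
    (X : Set (EuclideanSpace ℝ (Fin d))) ⊆ closure (X ∩ support (weightProduct w ψ m)) := by
  induction m with
  | zero => exact fun x hx ↦ subset_closure ⟨hx, by simp [weightProduct_zero]⟩
  | succ m ih =>
    refine ih.trans (closure_minimal (fun x hx ↦ ?_) isClosed_closure)
    have hopen : IsOpen ((X : Set (EuclideanSpace ℝ (Fin d))) ∩ support (weightProduct w ψ m)) :=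
      (contDiffOn_weightProduct hψ hψ_maps hw m).continuousOn.isOpen_inter_preimage X.isOpen
        isOpen_compl_singleton
    have hpreimage := (hψ.iterate hψ_maps m).subset_closure_inter_preimage
      ((hψ_maps.iterate m).image_subset.trans hw_dense)
    refine closure_mono ?_ (hopen.inter_closure ⟨hx, hpreimage hx.1⟩)
    rintro z ⟨⟨hz, hzm⟩, -, hzX, hzw⟩
    refine ⟨hz, ?_⟩
    rw [weightProduct_succ]
    exact mul_ne_zero (div_ne_zero hzw
      (Complex.ofReal_ne_zero.2 (abs_ne_zero.2 (hψ.det_ne_zero _ hzX)))) hzm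

theorem tsupport_iterate_transferCLM_subset (hψ : IsSmoothEmbedding X ψ) (hψ_maps : MapsTo ψ X X)
    (hw : ContDiffOn ℝ ∞ w X) (m : ℕ) (f : 𝓓(X, ℂ)) :
    tsupport ((transferCLM hψ hψ_maps hw)^[m] f) ⊆ ψ^[m] '' tsupport f := by
  rw [coe_iterate_transferCLM]
  exact (hψ.iterate hψ_maps m).tsupport_weightedPushforward_subset f.hasCompactSupport
    f.tsupport_subset

theorem isPowerBounded_weightedCompositionCLM (hψ : IsSmoothEmbedding X ψ)
    (hψ_maps : MapsTo ψ X X) (hw : ContDiffOn ℝ ∞ w X)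
    (hstable : HasStableOrbits (X : Set (EuclideanSpace ℝ (Fin d))) ψ)
    (hweight : WeightProductsBounded X w ψ) (hinv : InverseComponentsBounded X ψ) :
    IsPowerBounded (weightedCompositionCLM hψ hψ_maps hw) := by
  refine (isPowerBounded_precomp_iff _).2 fun B hB ↦ ?_
  have hunion : ⋃ m, (transferCLM hψ hψ_maps hw)^[m] '' B =
      range fun p : ℕ × B ↦ (transferCLM hψ hψ_maps hw)^[p.1] p.2 := by
    ext g
    simp
  rw [← Subtype.range_coe (s := B), isVonNBounded_range_iff] at hB
  obtain ⟨⟨K, hKX, hBK⟩, hB⟩ := hB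
  obtain ⟨L, hL, hLX, hKL⟩ := hstable K K.isCompact hKX
  have htsupport (p : ℕ × B) :
      tsupport ((transferCLM hψ hψ_maps hw)^[p.1] p.2) ⊆ ψ^[p.1] '' K :=
    (tsupport_iterate_transferCLM_subset hψ hψ_maps hw p.1 p.2).trans (image_mono (hBK p.2))
  rw [hunion, isVonNBounded_range_iff]
  refine ⟨⟨⟨L, hL⟩, hLX, fun p ↦ (htsupport p).trans (hKL p.1)⟩,
    .univ_of_tsupport_subset ?_ htsupport⟩
  have hW : IsSmoothlyBounded (fun m ↦ ψ^[m] '' K) fun m ↦ weightProduct w ψ m ∘ iterateInv X ψ m :=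
    iSup_cnSeminorm_lt_top_iff.1 (hweight K K.isCompact hKX)
  have hψ_inv : IsSmoothlyBounded (fun m ↦ ψ^[m] '' K) (iterateInv X ψ) :=
    .of_components (fun c ↦ iSup_cnSeminorm_lt_top_iff.1 fun n ↦ hinv K K.isCompact hKX n c)
      fun m y hy ↦ (hψ.iterate hψ_maps m).contDiffOn_invFunOn.contDiffAt
        (((hψ.iterate hψ_maps m).isOpen_image X.isOpen subset_rfl).mem_nhds (image_mono hKX hy))
  simp only [coe_iterate_transferCLM]
  exact .weightedPushforward hKX (fun p ↦ hψ.iterate hψ_maps p.1)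
    (fun p ↦ contDiffOn_weightProduct hψ hψ_maps hw p.1) (fun p ↦ p.2.1.contDiff.contDiffOn)
    (hW.comp_index Prod.fst) (hψ_inv.comp_index Prod.fst)
    ((hB.comp_index Prod.snd).mono fun _ ↦ subset_univ _)

theorem isVonNBounded_range_iterate_transferCLM {hψ : IsSmoothEmbedding X ψ}
    {hψ_maps : MapsTo ψ X X} {hw : ContDiffOn ℝ ∞ w X}
    (h : IsPowerBounded (weightedCompositionCLM hψ hψ_maps hw)) (f : 𝓓(X, ℂ)) :
    Bornology.IsVonNBounded ℂ (range fun m ↦ (transferCLM hψ hψ_maps hw)^[m] f) := by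
  simpa only [image_singleton, iUnion_singleton_eq_range] using
    (isPowerBounded_precomp_iff _).1 h {f} (Bornology.isVonNBounded_singleton f)

theorem hasStableOrbits_of_isPowerBounded {hψ : IsSmoothEmbedding X ψ} {hψ_maps : MapsTo ψ X X}
    {hw : ContDiffOn ℝ ∞ w X}
    (hw_dense : (X : Set (EuclideanSpace ℝ (Fin d))) ⊆ closure {x | x ∈ X ∧ w x ≠ 0})
    (h : IsPowerBounded (weightedCompositionCLM hψ hψ_maps hw)) :
    HasStableOrbits (X : Set (EuclideanSpace ℝ (Fin d))) ψ := by
  intro K hK hKX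
  obtain ⟨f, hf⟩ := exists_testFunction_eq hK hKX (1 : ℂ)
  obtain ⟨⟨L, hLX, hL⟩, -⟩ :=
    isVonNBounded_range_iff.1 (isVonNBounded_range_iterate_transferCLM h f)
  refine ⟨L, L.isCompact, hLX, fun m ↦ ?_⟩
  have hK_support : K ⊆ X ∩ support f := fun x hx ↦
    ⟨hKX hx, by rw [mem_support, hf.self_of_nhdsSet x hx]; exact one_ne_zero⟩
  calc ψ^[m] '' K ⊆ ψ^[m] '' (X ∩ support f) := image_mono hK_support
    _ ⊆ tsupport ((transferCLM hψ hψ_maps hw)^[m] f) := by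
      rw [coe_iterate_transferCLM]
      exact (hψ.iterate hψ_maps m).image_support_subset_tsupport_weightedPushforward
        (subset_closure_support_weightProduct hψ hψ_maps hw hw_dense m) f.continuous
    _ ⊆ L := hL m

theorem weightProductsBounded_of_isPowerBounded {hψ : IsSmoothEmbedding X ψ}
    {hψ_maps : MapsTo ψ X X} {hw : ContDiffOn ℝ ∞ w X}
    (h : IsPowerBounded (weightedCompositionCLM hψ hψ_maps hw)) : WeightProductsBounded X w ψ := by
  intro K hK hKX
  obtain ⟨f, hf⟩ := exists_testFunction_eq hK hKX (1 : ℂ)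
  obtain ⟨-, hbounded⟩ := isVonNBounded_range_iff.1 (isVonNBounded_range_iterate_transferCLM h f)
  refine iSup_cnSeminorm_lt_top_iff.2
    ((hbounded.mono fun _ ↦ subset_univ _).congr fun m y hy ↦ ?_)
  obtain ⟨x, hx, rfl⟩ := hy
  have hψm := hψ.iterate hψ_maps m
  obtain ⟨V, hV_subset, hV, hxV⟩ := mem_nhds_iff.1
    (Filter.inter_mem (mem_nhdsSet_iff_forall.1 hf x hx) (X.isOpen.mem_nhds (hKX hx)))
  filter_upwards [(hψm.isOpen_image hV fun z hz ↦ (hV_subset hz).2).mem_nhds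
    (mem_image_of_mem _ hxV)]
  rintro _ ⟨z, hz, rfl⟩
  obtain ⟨hzf, hzX⟩ : f z = 1 ∧ z ∈ X := hV_subset hz
  rw [coe_iterate_transferCLM, weightedPushforward_apply hψm.injOn hzX, hzf, smul_eq_mul, mul_one,
    comp_apply, iterateInv, hψm.injOn.leftInvOn_invFunOn hzX]

end PowerBoundedness

end WeightedComposition

theorem mainTheorem3 {d : ℕ} (X : Opens (EuclideanSpace ℝ (Fin d)))
    (w : EuclideanSpace ℝ (Fin d) → ℂ) (hw : ContDiffOn ℝ ∞ w X)
    (hw_dense : (X : Set (EuclideanSpace ℝ (Fin d))) ⊆ closure {x | x ∈ X ∧ w x ≠ 0})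
    (ψ : EuclideanSpace ℝ (Fin d) → EuclideanSpace ℝ (Fin d)) (hψ : ContDiffOn ℝ ∞ ψ X)
    (hψ_maps : MapsTo ψ X X) (hψ_inj : InjOn ψ X) (hψ_det : ∀ x ∈ X, (fderiv ℝ ψ x).det ≠ 0) :
    -- the weighted composition operator on `𝓓'(X)` exists and is unique
    (∃! T : WeightedComposition.Distr X →L[ℂ] WeightedComposition.Distr X,
      WeightedComposition.IsWeightedCompositionOperator X w ψ T) ∧
    ∀ C : WeightedComposition.Distr X →L[ℂ] WeightedComposition.Distr X,
      WeightedComposition.IsWeightedCompositionOperator X w ψ C →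
      -- i) implies ii)
      ((WeightedComposition.HasStableOrbits (X : Set (EuclideanSpace ℝ (Fin d))) ψ ∧
          WeightedComposition.WeightProductsBounded X w ψ ∧
          WeightedComposition.InverseComponentsBounded X ψ →
        WeightedComposition.IsPowerBounded C) ∧
      -- ii) implies iii)
      (WeightedComposition.IsPowerBounded C →
        WeightedComposition.HasStableOrbits (X : Set (EuclideanSpace ℝ (Fin d))) ψ ∧
          WeightedComposition.WeightProductsBounded X w ψ)) := by
  have hψ' : WeightedComposition.IsSmoothEmbedding X ψ := ⟨hψ, hψ_inj, hψ_det⟩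
  have hT := WeightedComposition.isWeightedCompositionOperator_weightedCompositionCLM hψ' hψ_maps hw
  have huniq : ∀ C : WeightedComposition.Distr X →L[ℂ] WeightedComposition.Distr X,
      WeightedComposition.IsWeightedCompositionOperator X w ψ C →
        C = WeightedComposition.weightedCompositionCLM hψ' hψ_maps hw := fun C hC ↦
    WeightedComposition.eq_of_eq_on_regularDistr fun g hg ↦ (hC g hg).trans (hT g hg).symm
  refine ⟨⟨_, hT, huniq⟩, fun C hC ↦ ?_⟩
  rw [huniq C hC]
  exact ⟨fun ⟨hstable, hweight, hinv⟩ ↦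
      WeightedComposition.isPowerBounded_weightedCompositionCLM hψ' hψ_maps hw hstable hweight hinv,
    fun h ↦ ⟨WeightedComposition.hasStableOrbits_of_isPowerBounded hw_dense h,
      WeightedComposition.weightProductsBounded_of_isPowerBounded h⟩⟩
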